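/- **Setting.** Let $\mathcal X$ be a compact topological space with its Borel $\sigma$-algebra, and let $G$ be a continuous symmetric positive semidefinite kernel on $\mathcal X$ with RKHS $\mathcal H_G$ and $G(s,s)\le\gamma^2$ for all $s$. For a Borel probability measure $x$ on $\mathcal X$ let $\mu_x=\int G(s,\cdot)\,dx(s)\in\mathcal H_G$ be its mean embedding, and let $\Xi\subset\mathcal H_G$ be the set of all these mean embeddings. Let $K$ be a kernel on $\Xi$ with RKHS $\mathcal H_K$ such that $K(\xi,\xi)\le\kappa^2$ for all $\xi\in\Xi$ and, with $K_\xi=K(\xi,\cdot)$, $\|K_{\xi_1}-K_{\xi_2}\|_{\mathcal H_K}\le L\|\xi_1-\xi_2\|_{\mathcal H_G}^\alpha$ for all $\xi_1,\xi_2\in\Xi$, where $\alpha\in(0,1]$, $L>0$. *First stage:* $(x_j,y_j)$, $j=1,\dots,n$, $n\ge1$, are i.i.d. from a distribution on pairs (Borel probability measure on $\mathcal X$, real label) with $|y|\le M$ almost surely, $M>0$. *Second stage:* given the first stage, the points $x_{j,i}$, $i=1,\dots,N$, $N\ge1$, are independent with $x_{j,i}\sim x_j$; put $\hat x_j=\frac1N\sum_{i=1}^N\delta_{x_{j,i}}$.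 Write $D$ for the first-stage sample and $\mathbb E_{\hat D|D}$ for the expectation over the second stage given the first. Let $\rho$ be the law of $(\mu_x,y)$, $\rho_\mu$ its marginal on $\Xi$, $f_\rho(\mu_x)=\int y\,d\rho(y|\mu_x)$ the regression function, $S_K:\mathcal H_K\to L^2(\rho_\mu)$ the inclusion, $T_K=S_K^*S_K$, $L_K=S_KS_K^*$ and $\mathcal N(\lambda)=\operatorname{trace}(L_K(L_K+\lambda)^{-1})$. For a step size $\eta>0$ let $f_0=\hat f_0=0$ and, for $t\ge 0$, $$f_{t+1}=f_t-\frac{\eta}{n}\sum_{j=1}^n(f_t(\mu_{x_j})-y_j)K_{\mu_{x_j}},\qquad \hat f_{t+1}=\hat f_t-\frac{\eta}{n}\sum_{j=1}^n(\hat f_t(\mu_{\hat x_j})-y_j)K_{\mu_{\hat x_j}},$$ with tail averages $\bar f_T=\frac2T\sum_{t=\lfloor T/2\rfloor+1}^Tf_t$ and $\bar{\hat f}_T=\frac2T\sum_{t=\lfloor T/2\rfloor+1}^T\hat f_t$. **Proposition (Second Stage GD Variance).** Let $\delta\in(0,1]$, $\eta\kappa^2<1$, $T\ge3$, $\lambda=1/(\eta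 T)$ and assume $$n\ \ge\ \frac{32\kappa^2\log(4/\delta)}{\lambda}\,\log\!\Big(e\,\mathcal N(\lambda)\Big(1+\frac{\lambda}{\|T_K\|}\Big)\Big).$$ Put $$\mathcal B(1/\eta T)=\frac{2\eta T}{n}+\sqrt{\frac{\eta T\,\mathcal N(1/\eta T)}{n}}+\frac{\eta T}{N^{\alpha/2}}+1 .$$ 1. If $f_\rho\in\operatorname{Ran}(S_K)$, then with probability at least $1-\delta$ over $D$, $$\mathbb E_{\hat D|D}\big[\|S_K(\bar{\hat f}_T-\bar f_T)\|_{L^2(\rho_\mu)}\big]\ \le\ C\,\log(4/\delta)\,\log(T)\,\frac{\sqrt{\eta T}}{N^{\alpha/2}}\,\mathcal B(1/\eta T),$$ where $C<\infty$ depends only on $\kappa,\gamma,L,\alpha,M$. 2. If $f_\rho\notin\operatorname{Ran}(S_K)$, and $r>0$, $R<\infty$, $\nu\in(0,1]$, $c_\nu<\infty$ are such that $f_\rho=L_K^rh_\rho$ for some $h_\rho\in L^2(\rho_\mu)$ with $\|h_\rho\|_{L^2(\rho_\mu)}\le R$, and $\mathcal N(\lambda')\le c_\nu\lambda'^{-\nu}$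 for all $\lambda'>0$, then with probability at least $1-\delta$ over $D$, $$\mathbb E_{\hat D|D}\big[\|S_K(\bar{\hat f}_T-\bar f_T)\|_{L^2(\rho_\mu)}\big]\ \le\ C\,\log(4/\delta)\,\log(T)\,\frac{\sqrt{\eta T}\,\mathcal B(1/\eta T)}{N^{\alpha/2}}\Big(1+(\eta T)^{\frac12\max\{\nu,\,1-2r\}}\Big),$$ where $C<\infty$ depends only on $\kappa,\gamma,L,\alpha,M,r$. -/

import Mathlib

open MeasureTheory ProbabilityTheory

universe u v w

noncomputable section

namespace DistReg

section Operators

variable {E : Type*} [NormedAddCommGroup E] [InnerProductSpace ℝ E] [CompleteSpace E]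

/-- The trace `∑ᵢ ⟨eᵢ, A eᵢ⟩` of a trace-class operator on a Hilbert space, computed in some
Hilbert basis `(eᵢ)` (the value does not depend on the basis for trace-class operators). -/
def opTrace (A : E →L[ℝ] E) : ℝ :=
  ∑' i, inner ℝ ((exists_hilbertBasis ℝ E).choose_spec.choose i)
    (A ((exists_hilbertBasis ℝ E).choose_spec.choose i))

/-- The power `A ^ r`, `r > 0`, of a compact positive self-adjoint operator, by the spectral
theorem: `A ^ r h = ∑_σ σ ^ r • P_σ h`, where `P_σ` is the orthogonal projection onto
`ker (A - σ)`. This projection is zero unless `σ` is an eigenvalue, so the sum runs over the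
eigenvalues of `A`. -/
def compactPow (A : E →L[ℝ] E) (r : ℝ) (h : E) : E :=
  ∑' σ : ℝ, (σ ^ r) • (A - σ • (1 : E →L[ℝ] E)).ker.starProjection h

/-- The effective dimension `trace (A (A + lam)⁻¹)` of a positive operator `A`. -/
def effDim (A : E →L[ℝ] E) (lam : ℝ) : ℝ :=
  opTrace (A * Ring.inverse (A + lam • (1 : E →L[ℝ] E)))

end Operators

section RKHS

/-- The kernel section `k(x, ·)` as an element of a real-valued RKHS. -/
def kerSec (H : Type*) {X : Type*} [NormedAddCommGroup H] [InnerProductSpace ℝ H]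
    [CompleteSpace H] [RKHS ℝ H X ℝ] (x : X) : H :=
  RKHS.kerFun H x (1 : ℝ)

/-- The kernel `k(x, y)` of a real-valued RKHS as a real number. -/
def ker (H : Type*) {X : Type*} [NormedAddCommGroup H] [InnerProductSpace ℝ H]
    [CompleteSpace H] [RKHS ℝ H X ℝ] (x y : X) : ℝ :=
  RKHS.kernel H x y (1 : ℝ)

variable {H : Type*} {X : Type*} [NormedAddCommGroup H] [InnerProductSpace ℝ H]
  [CompleteSpace H] [RKHS ℝ H X ℝ]

lemma inner_kerSec (x : X) (f : H) : inner ℝ (kerSec H x) f = f x := by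
  simp [kerSec]

lemma inner_kerSec_kerSec (x y : X) : inner ℝ (kerSec H x) (kerSec H y) = ker H x y := by
  rw [inner_kerSec, kerSec, RKHS.kerFun_apply, ker]

lemma norm_kerSec_le {κ : ℝ} (hκ : 0 ≤ κ) {x : X} (h : ker H x x ≤ κ ^ 2) :
    ‖kerSec H x‖ ≤ κ := by
  rw [← inner_kerSec_kerSec, real_inner_self_eq_norm_sq] at h
  exact abs_le_of_sq_le_sq' h hκ |>.2

lemma abs_apply_le {κ : ℝ} (hκ : 0 ≤ κ) {x : X} (h : ker H x x ≤ κ ^ 2) (f : H) :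
    |f x| ≤ κ * ‖f‖ := by
  rw [← inner_kerSec]
  exact (abs_real_inner_le_norm _ _).trans
    (mul_le_mul_of_nonneg_right (norm_kerSec_le hκ h) (norm_nonneg _))

/-- The canonical inclusion `S : H → L²(ν)`, `f ↦ [f]`, of an RKHS with bounded kernel and
measurable functions. -/
def l2Incl [MeasurableSpace X] (ν : Measure X) [IsFiniteMeasure ν] {κ : ℝ} (hκ : 0 ≤ κ)
    (hker : ∀ x, ker H x x ≤ κ ^ 2) (hmeas : ∀ f : H, Measurable fun x => f x) :
    H →L[ℝ] Lp ℝ 2 ν :=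
  have hmem : ∀ f : H, MemLp (fun x => f x) 2 ν := fun f =>
    MemLp.of_bound (hmeas f).aestronglyMeasurable (κ * ‖f‖)
      (Filter.Eventually.of_forall fun x => by
        simpa [Real.norm_eq_abs] using abs_apply_le hκ (hker x) f)
  LinearMap.mkContinuous
    { toFun := fun f => (hmem f).toLp _
      map_add' := fun f g => by
        rw [← MemLp.toLp_add]
        congr 1
        exact RKHS.coe_add f g
      map_smul' := fun c f => by
        rw [RingHom.id_apply, ← MemLp.toLp_const_smul]
        congr 1
        exact (RKHS.coeCLM ℝ).map_smul c f }
    ((measureUnivNNReal ν : ℝ) ^ (ENNReal.toReal 2)⁻¹ * κ)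
    (fun f => by
      rw [mul_assoc]
      refine Lp.norm_le_of_ae_bound (by positivity) ?_
      filter_upwards [MemLp.coeFn_toLp (hmem f)] with x hx
      change ‖((hmem f).toLp _ : Lp ℝ 2 ν) x‖ ≤ _
      rw [hx]
      simpa [Real.norm_eq_abs] using abs_apply_le hκ (hker x) f)

/-- The covariance operator `T = S* S` on `H`. -/
def covOp [MeasurableSpace X] {ν : Measure X} (S : H →L[ℝ] Lp ℝ 2 ν) : H →L[ℝ] H :=
  S.adjoint ∘L S

/-- The kernel integral operator `S S*` on `L²(ν)`. -/
def intOp [MeasurableSpace X] {ν : Measure X} (S : H →L[ℝ] Lp ℝ 2 ν) :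
    Lp ℝ 2 ν →L[ℝ] Lp ℝ 2 ν :=
  S ∘L S.adjoint

/-- Gradient descent for the empirical least-squares risk of `(p j, y j)`, `j = 1, …, n`, with
constant step size `η`, started at zero. -/
def gd (H : Type*) {X : Type*} [NormedAddCommGroup H] [InnerProductSpace ℝ H]
    [CompleteSpace H] [RKHS ℝ H X ℝ] {n : ℕ} (p : Fin n → X) (y : Fin n → ℝ) (η : ℝ) : ℕ → H
  | 0 => 0
  | t + 1 => gd H p y η t -
      (η * (1 / (n : ℝ))) • ∑ j, (gd H p y η t (p j) - y j) • kerSec H (p j)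

/-- The tail average `(2 / T) ∑_{t = ⌊T/2⌋ + 1}^T f_t` of the gradient descent iterates. -/
def tailGD (H : Type*) {X : Type*} [NormedAddCommGroup H] [InnerProductSpace ℝ H]
    [CompleteSpace H] [RKHS ℝ H X ℝ] {n : ℕ} (p : Fin n → X) (y : Fin n → ℝ) (η : ℝ)
    (T : ℕ) : H :=
  (2 / (T : ℝ)) • ∑ t ∈ Finset.Icc (T / 2 + 1) T, gd H p y η t

end RKHS

section Embedding

variable {X : Type*} [TopologicalSpace X] [MeasurableSpace X]
variable (HG : Type*) [NormedAddCommGroup HG] [InnerProductSpace ℝ HG] [CompleteSpace HG]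
  [RKHS ℝ HG X ℝ]

/-- The kernel mean embedding `μ_x = ∫ G(s, ·) dx(s)`. -/
def meanEmb (x : ProbabilityMeasure X) : HG :=
  ∫ s, kerSec HG s ∂(x : Measure X)

/-- The set of all mean embeddings of Borel probability measures, as a subspace of `HG`. -/
abbrev EmbSpace : Type _ := Set.range (meanEmb HG : ProbabilityMeasure X → HG)

/-- The mean embedding as a map onto its image. -/
def emb (x : ProbabilityMeasure X) : EmbSpace HG := ⟨meanEmb HG x, x, rfl⟩

/-- The empirical distribution `(1 / N) ∑ᵢ δ_{s i}` of a nonempty bag. -/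
def empirical {N : ℕ} [NeZero N] (s : Fin N → X) : ProbabilityMeasure X :=
  ⟨(N : ENNReal)⁻¹ • ∑ i, Measure.dirac (s i), ⟨by
    simp [ENNReal.inv_mul_cancel (Nat.cast_ne_zero.mpr (NeZero.ne N)) (ENNReal.natCast_ne_top N)]⟩⟩

variable [MeasurableSpace HG]

/-- The law `ρ` of `(μ_x, y)` when `(x, y)` follows the meta distribution. -/
def lawZ (P : Measure (ProbabilityMeasure X × ℝ)) : Measure (EmbSpace HG × ℝ) :=
  P.map fun z => (emb HG z.1, z.2)

instance (P : Measure (ProbabilityMeasure X × ℝ)) [IsFiniteMeasure P] :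
    IsFiniteMeasure (lawZ HG P) := by
  unfold lawZ; infer_instance

/-- The marginal `ρ_μ` of `ρ` on the space of mean embeddings. -/
def lawMu (P : Measure (ProbabilityMeasure X × ℝ)) : Measure (EmbSpace HG) :=
  (lawZ HG P).fst

instance (P : Measure (ProbabilityMeasure X × ℝ)) [IsFiniteMeasure P] :
    IsFiniteMeasure (lawMu HG P) := by
  unfold lawMu; infer_instance

/-- The regression function `f_ρ(μ_x) = ∫ y dρ(y | μ_x)`. -/
def regFun (P : Measure (ProbabilityMeasure X × ℝ)) [IsFiniteMeasure P] (ξ : EmbSpace HG) : ℝ :=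
  ∫ y, y ∂((lawZ HG P).condKernel ξ)

variable (HK : Type*) [NormedAddCommGroup HK] [InnerProductSpace ℝ HK] [CompleteSpace HK]
  [RKHS ℝ HK (EmbSpace HG) ℝ]

/-- The assumptions on the two kernels: `G` is a Mercer kernel with `G(s, s) ≤ γ²`, the kernel `K`
on the space of mean embeddings satisfies `K(ξ, ξ) ≤ κ²`, and `ξ ↦ K(ξ, ·)` is `(α, L)`-Hölder.
(Symmetry and positive semidefiniteness are automatic for reproducing kernels.) -/
structure KernelAssumptions (κ γ L α : ℝ) : Prop where
  continuous_G : Continuous fun p : X × X => ker HG p.1 p.2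
  bound_G : ∀ s : X, ker HG s s ≤ γ ^ 2
  bound_K : ∀ ξ : EmbSpace HG, ker HK ξ ξ ≤ κ ^ 2
  holder_K : ∀ ξ₁ ξ₂ : EmbSpace HG,
    ‖kerSec HK ξ₁ - kerSec HK ξ₂‖ ≤ L * ‖(ξ₁ : HG) - (ξ₂ : HG)‖ ^ α

variable {HG HK}

lemma KernelAssumptions.measurable [BorelSpace HG] {κ γ L α : ℝ} (hα : 0 < α)
    (h : KernelAssumptions HG HK κ γ L α) (f : HK) : Measurable fun ξ => f ξ := by
  have hc : Continuous fun ξ : EmbSpace HG => kerSec HK ξ := by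
    rw [continuous_iff_continuousAt]
    intro ξ₀
    rw [ContinuousAt, tendsto_iff_norm_sub_tendsto_zero]
    have h0 : Filter.Tendsto (fun ξ : EmbSpace HG => L * ‖(ξ : HG) - (ξ₀ : HG)‖ ^ α)
        (nhds ξ₀) (nhds (L * ‖(ξ₀ : HG) - (ξ₀ : HG)‖ ^ α)) := by
      refine Filter.Tendsto.const_mul L ?_
      refine Filter.Tendsto.rpow_const ?_ (Or.inr hα.le)
      exact (Continuous.tendsto (by fun_prop) ξ₀)
    rw [sub_self, norm_zero, Real.zero_rpow hα.ne', mul_zero] at h0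
    exact squeeze_zero (fun _ => norm_nonneg _) (fun ξ => h.holder_K ξ ξ₀) h0
  have hf : Continuous fun ξ : EmbSpace HG => f ξ := by
    simp_rw [← inner_kerSec]
    fun_prop
  exact hf.measurable

/-- The canonical inclusion `S_K` of `HK` into `L²(ρ_μ)`. -/
def SK [BorelSpace HG] {κ γ L α : ℝ} (hκ : 0 ≤ κ) (hα : 0 < α)
    (h : KernelAssumptions HG HK κ γ L α)
    (P : Measure (ProbabilityMeasure X × ℝ)) [IsFiniteMeasure P] :
    HK →L[ℝ] Lp ℝ 2 (lawMu HG P) :=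
  l2Incl (lawMu HG P) hκ h.bound_K (h.measurable hα)

/-- The well-specified case `f_ρ ∈ Ran S_K`, as an identity in `L²(ρ_μ)`. -/
def WellSpecified (P : Measure (ProbabilityMeasure X × ℝ)) [IsFiniteMeasure P]
    (S : HK →L[ℝ] Lp ℝ 2 (lawMu HG P)) : Prop :=
  ∃ w : HK, (S w : EmbSpace HG → ℝ) =ᵐ[lawMu HG P] regFun HG P

/-- The source condition `f_ρ = L_K ^ r h` with `‖h‖ ≤ R`, where `L_K = S_K S_K*`. -/
def SourceCondition (P : Measure (ProbabilityMeasure X × ℝ)) [IsFiniteMeasure P]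
    (S : HK →L[ℝ] Lp ℝ 2 (lawMu HG P)) (r R : ℝ) : Prop :=
  ∃ h : Lp ℝ 2 (lawMu HG P), ‖h‖ ≤ R ∧
    ((compactPow (intOp S) r h : Lp ℝ 2 (lawMu HG P)) : EmbSpace HG → ℝ) =ᵐ[lawMu HG P] regFun HG P

/-- The law of the second-stage sample given the first-stage sample `z = ((x_j, y_j))_j`: the
points `x_{j,i}` are independent, and `x_{j,i}` has law `x_j`. -/
def secondStage {n : ℕ} (N : ℕ) (z : Fin n → ProbabilityMeasure X × ℝ) :
    Measure (Fin n → Fin N → X) :=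
  Measure.pi fun j => Measure.pi fun _ : Fin N => ((z j).1 : Measure X)

/-- `‖S_K (tail-averaged second-stage GD - tail-averaged first-stage GD)‖_{L²}` for the
first-stage sample `z` and the second-stage sample `s`. -/
def gdGap {n N : ℕ} [NeZero N] {ν : Measure (EmbSpace HG)} (S : HK →L[ℝ] Lp ℝ 2 ν) (η : ℝ) (T : ℕ)
    (z : Fin n → ProbabilityMeasure X × ℝ) (s : Fin n → Fin N → X) : ℝ :=
  ‖S (tailGD HK (fun j => emb HG (empirical (s j))) (fun j => (z j).2) η T -
    tailGD HK (fun j => emb HG (z j).1) (fun j => (z j).2) η T)‖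

/-- With probability at least `1 - δ` over the i.i.d. first-stage sample `z`, the conditional
expectation of `gdGap` over the second-stage sample given `z` is finite and at most `b`. -/
def GapBound (P : Measure (ProbabilityMeasure X × ℝ)) {ν : Measure (EmbSpace HG)}
    (S : HK →L[ℝ] Lp ℝ 2 ν) (n N : ℕ) [NeZero N] (η : ℝ) (T : ℕ) (δ b : ℝ) : Prop :=
  (Measure.pi fun _ : Fin n => P)
    {z | ¬ (Integrable (gdGap (N := N) S η T z) (secondStage N z) ∧
      ∫ s, gdGap (N := N) S η T z s ∂(secondStage N z) ≤ b)} ≤ ENNReal.ofReal δ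

end Embedding

/-- `𝓑(1 / (ηT)) = 2ηT / n + √(ηT 𝓝(1 / (ηT)) / n) + ηT / N^{α/2} + 1`. -/
def calB {E : Type*} [NormedAddCommGroup E] [InnerProductSpace ℝ E] [CompleteSpace E]
    (A : E →L[ℝ] E) (n N : ℕ) (α η : ℝ) (T : ℕ) : ℝ :=
  2 * (η * T) / n + √(η * T * effDim A (1 / (η * T)) / n) + η * T / (N : ℝ) ^ (α / 2) + 1

/-- `φ(u) = u ^ (max {ν, 1 - 2r} / 2)`. -/
def phi (ν r u : ℝ) : ℝ := u ^ (1 / 2 * max ν (1 - 2 * r))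

end DistReg

end

open DistReg

/-!
Both parts follow from a single estimate (`gapBound_of_bounded_labels`), in which the regression
function enters only through the bound `M` on the labels: the norms of the first-stage iterates are
estimated by `M √(η t)`, and their growth is compensated by the smoothing of the iteration.

Write `A` and `A'` for the normalized sampling operators of the two samples (`sampOp`), so that
gradient descent is the Landweber iteration for `A f = b` and `A' f = b` (`gd_eq_landweber`), `b` the
vector of labels. The difference of the two iterations solves a linear recursion with the
contraction `1 - η A'* A'` and a source that has two parts: `η (A' - A)* (b - A f_t)`, which is small
since residuals never exceed `b`, and `-η A'* (A' - A) f_t`, which involves the growing `f_t` but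
lies in the range of `A'*`, where the iteration smooths. Summing the smoothing bounds
`‖A' (1 - η A'* A') ^ k A'*‖ ≤ 2 / (η (k + 1))` produces the factor `log T`
(`norm_map_landweber_sub_le`, `norm_landweber_sub_le`).

To return from the empirical seminorm to `L²(ρ_μ)`, the covariance operator has to be dominated by
the empirical one: `‖S h‖² ≤ 2 ‖A h‖² + lam₁ ‖h‖²` for all `h`, with probability at least `1 - δ / 2`
(`measure_not_covariance_le`). Here `lam₁` exceeds `1 / (η T)` by a multiple of
`κ² (1 + 2 𝓝) log (4 / δ) / n`, whose size relative to `1 / (η T)` is absorbed in `𝓑`. The proof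
applies a Bernstein inequality for Hilbert space valued sums, which follows from Pinelis' estimate of
`cosh ‖·‖` (`cosh_norm_add_le`), to the tensor squares of whitened kernel sections; their mean square
norm is governed by the effective dimension (`integral_norm_whiten_sq_eq_effDim`).

Finally `‖A' - A‖²` is at most the mean square distance of the kernel sections, whose conditional
expectation is of order `N ^ (-α)` by independence within the bags and the Hölder condition
(`integral_sampleDist_le`).
-/

namespace DistReg

/-! ### Landweber iteration -/

lemma pow_succ_apply {E : Type*} [NormedAddCommGroup E] [NormedSpace ℝ E] (B : E →L[ℝ] E) (k : ℕ)
    (x : E) : (B ^ (k + 1)) x = B ((B ^ k) x) := by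
  rw [pow_succ']; rfl

section Landweber

open ContinuousLinearMap

variable {E F : Type*} [NormedAddCommGroup E] [InnerProductSpace ℝ E] [CompleteSpace E]
  [NormedAddCommGroup F] [InnerProductSpace ℝ F] [CompleteSpace F]

/-- The Landweber iteration for `A x = b`: gradient descent for `‖A x - b‖² / 2` with step size `η`,
started at zero. -/
noncomputable def landweber (A : E →L[ℝ] F) (b : F) (η : ℝ) : ℕ → E
  | 0 => 0
  | t + 1 => landweber A b η t - η • A.adjoint (A (landweber A b η t) - b)

/-- The operator `1 - η A* A` by which one Landweber step contracts the error. -/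
noncomputable def stepOp (A : E →L[ℝ] F) (η : ℝ) : E →L[ℝ] E := 1 - η • (A.adjoint ∘L A)

lemma stepOp_apply (A : E →L[ℝ] F) (η : ℝ) (x : E) :
    stepOp A η x = x - η • A.adjoint (A x) := rfl

variable {A : E →L[ℝ] F} {η : ℝ}

lemma norm_smul_adjoint_sq_le (hη : 0 ≤ η) (hA : η * ‖A‖ ^ 2 ≤ 1) (e : F) :
    ‖η • A.adjoint e‖ ^ 2 ≤ η * ‖e‖ ^ 2 := by
  have h1 : ‖A.adjoint e‖ ^ 2 ≤ ‖A‖ ^ 2 * ‖e‖ ^ 2 := by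
    rw [← mul_pow, ← LinearIsometryEquiv.norm_map (adjoint : (E →L[ℝ] F) ≃ₗᵢ⋆[ℝ] _) A]
    exact pow_le_pow_left₀ (norm_nonneg _) (le_opNorm _ _) 2
  rw [norm_smul, mul_pow, Real.norm_of_nonneg hη]
  calc η ^ 2 * ‖A.adjoint e‖ ^ 2 ≤ η ^ 2 * (‖A‖ ^ 2 * ‖e‖ ^ 2) := by gcongr
    _ = η * (η * ‖A‖ ^ 2) * ‖e‖ ^ 2 := by ring
    _ ≤ η * 1 * ‖e‖ ^ 2 := by gcongr
    _ = η * ‖e‖ ^ 2 := by ring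

lemma norm_stepOp_sq_le (hη : 0 ≤ η) (hA : η * ‖A‖ ^ 2 ≤ 1) (x : E) :
    ‖stepOp A η x‖ ^ 2 ≤ ‖x‖ ^ 2 - η * ‖A x‖ ^ 2 := by
  have h := norm_smul_adjoint_sq_le hη hA (A x)
  rw [stepOp_apply, norm_sub_sq_real, inner_smul_right, adjoint_inner_right,
    real_inner_self_eq_norm_sq]
  linarith

lemma norm_stepOp_le (hη : 0 ≤ η) (hA : η * ‖A‖ ^ 2 ≤ 1) (x : E) : ‖stepOp A η x‖ ≤ ‖x‖ := by
  refine le_of_sq_le_sq ?_ (norm_nonneg _)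
  have := norm_stepOp_sq_le hη hA x
  have : 0 ≤ η * ‖A x‖ ^ 2 := by positivity
  linarith

lemma norm_stepOp_pow_le (hη : 0 ≤ η) (hA : η * ‖A‖ ^ 2 ≤ 1) (k : ℕ) (x : E) :
    ‖(stepOp A η ^ k) x‖ ≤ ‖x‖ := by
  induction k with
  | zero => simp
  | succ k ih => rw [pow_succ_apply]; exact (norm_stepOp_le hη hA _).trans ih

lemma map_stepOp (x : E) : A (stepOp A η x) = stepOp A.adjoint η (A x) := by
  simp [stepOp_apply]

lemma stepOp_pow_adjoint (k : ℕ) (e : F) :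
    (stepOp A η ^ k) (A.adjoint e) = A.adjoint ((stepOp A.adjoint η ^ k) e) := by
  induction k with
  | zero => simp
  | succ k ih =>
    rw [pow_succ_apply, pow_succ_apply, ih, map_stepOp, adjoint_adjoint]

lemma mul_norm_adjoint_sq_le_one (hA : η * ‖A‖ ^ 2 ≤ 1) : η * ‖A.adjoint‖ ^ 2 ≤ 1 := by
  rwa [LinearIsometryEquiv.norm_map]

/-- The smoothing property of the iteration. It rests on `∑ₖ η ‖A (1 - η A* A) ^ k x‖² ≤ ‖x‖²`
together with the monotonicity of the summands, so that no spectral calculus is needed. -/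
lemma mul_norm_map_stepOp_pow_sq_le (hη : 0 ≤ η) (hA : η * ‖A‖ ^ 2 ≤ 1) (k : ℕ) (x : E) :
    η * (k + 1) * ‖A ((stepOp A η ^ k) x)‖ ^ 2 ≤ ‖x‖ ^ 2 := by
  have key : ‖(stepOp A η ^ k) x‖ ^ 2 + k * (η * ‖A ((stepOp A η ^ k) x)‖ ^ 2) ≤ ‖x‖ ^ 2 := by
    induction k with
    | zero => simp
    | succ k ih =>
      rw [pow_succ_apply]
      set y := (stepOp A η ^ k) x
      have h1 := norm_stepOp_sq_le hη hA y
      have h2 : ‖A (stepOp A η y)‖ ^ 2 ≤ ‖A y‖ ^ 2 := by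
        rw [map_stepOp]
        exact pow_le_pow_left₀ (norm_nonneg _)
          (norm_stepOp_le hη (mul_norm_adjoint_sq_le_one hA) _) 2
      have h3 : ((k + 1 : ℕ) : ℝ) * (η * ‖A (stepOp A η y)‖ ^ 2)
          ≤ ((k + 1 : ℕ) : ℝ) * (η * ‖A y‖ ^ 2) := by gcongr
      push_cast at h3 ⊢
      linarith
  have h4 := norm_stepOp_sq_le hη hA ((stepOp A η ^ k) x)
  have h5 := sq_nonneg ‖stepOp A η ((stepOp A η ^ k) x)‖
  linarith

lemma norm_map_stepOp_pow_le (hη : 0 < η) (hA : η * ‖A‖ ^ 2 ≤ 1) (k : ℕ) (x : E) :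
    ‖A ((stepOp A η ^ k) x)‖ ≤ ‖x‖ / √(η * (k + 1)) := by
  rw [le_div_iff₀ (by positivity)]
  refine le_of_sq_le_sq ?_ (norm_nonneg _)
  rw [mul_pow, Real.sq_sqrt (by positivity), mul_comm]
  exact mul_norm_map_stepOp_pow_sq_le hη.le hA k x

lemma norm_stepOp_pow_adjoint_le (hη : 0 < η) (hA : η * ‖A‖ ^ 2 ≤ 1) (k : ℕ) (e : F) :
    ‖(stepOp A η ^ k) (A.adjoint e)‖ ≤ ‖e‖ / √(η * (k + 1)) := by
  rw [stepOp_pow_adjoint]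
  exact norm_map_stepOp_pow_le hη (mul_norm_adjoint_sq_le_one hA) k e

lemma norm_map_stepOp_pow_adjoint_le (hη : 0 < η) (hA : η * ‖A‖ ^ 2 ≤ 1) (k : ℕ) (e : F) :
    ‖A ((stepOp A η ^ k) (A.adjoint e))‖ ≤ 2 * ‖e‖ / (η * (k + 1)) := by
  -- Half of the powers smooth on the left, the other half on the right.
  obtain ⟨i, j, hij, hi, hj⟩ : ∃ i j : ℕ, i + j = k ∧ k + 1 ≤ 2 * (i + 1) ∧ k + 1 ≤ 2 * (j + 1) :=
    ⟨k / 2, k - k / 2, by omega, by omega, by omega⟩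
  have hi' : ((k : ℝ) + 1) / 2 ≤ i + 1 := by
    have : ((k + 1 : ℕ) : ℝ) ≤ ((2 * (i + 1) : ℕ) : ℝ) := by exact_mod_cast hi
    push_cast at this; linarith
  have hj' : ((k : ℝ) + 1) / 2 ≤ j + 1 := by
    have : ((k + 1 : ℕ) : ℝ) ≤ ((2 * (j + 1) : ℕ) : ℝ) := by exact_mod_cast hj
    push_cast at this; linarith
  have hsplit : (stepOp A η ^ k) (A.adjoint e) =
      (stepOp A η ^ i) ((stepOp A η ^ j) (A.adjoint e)) := by
    rw [← hij, pow_add]; rfl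
  rw [hsplit]
  calc _ ≤ ‖(stepOp A η ^ j) (A.adjoint e)‖ / √(η * (i + 1)) := norm_map_stepOp_pow_le hη hA i _
    _ ≤ ‖e‖ / √(η * (j + 1)) / √(η * (i + 1)) := by
        gcongr; exact norm_stepOp_pow_adjoint_le hη hA j e
    _ ≤ ‖e‖ / √(η * ((k + 1) / 2)) / √(η * ((k + 1) / 2)) := by gcongr
    _ = 2 * ‖e‖ / (η * (k + 1)) := by
        rw [div_div, Real.mul_self_sqrt (by positivity)]
        field_simp

variable (b : F)

lemma norm_residual_landweber_le (hη : 0 ≤ η) (hA : η * ‖A‖ ^ 2 ≤ 1) (t : ℕ) :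
    ‖b - A (landweber A b η t)‖ ≤ ‖b‖ := by
  induction t with
  | zero => simp [landweber]
  | succ t ih =>
    have : b - A (landweber A b η (t + 1)) =
        stepOp A.adjoint η (b - A (landweber A b η t)) := by
      simp only [landweber, stepOp_apply, map_sub, map_smul, adjoint_adjoint, smul_sub]
      abel
    rw [this]
    exact (norm_stepOp_le hη (mul_norm_adjoint_sq_le_one hA) _).trans ih

lemma norm_landweber_sq_le (hη : 0 ≤ η) (hA : η * ‖A‖ ^ 2 ≤ 1) (t : ℕ) :
    ‖landweber A b η t‖ ^ 2 ≤ η * t * ‖b‖ ^ 2 := by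
  induction t with
  | zero => simp [landweber]
  | succ t ih =>
    set r := b - A (landweber A b η t) with hr
    have h1 : landweber A b η (t + 1) = landweber A b η t + η • A.adjoint r := by
      rw [landweber, hr, ← neg_sub b, map_neg, smul_neg, sub_neg_eq_add]
    have h2 := norm_smul_adjoint_sq_le hη hA r
    have h3 : inner ℝ (A (landweber A b η t)) r = inner ℝ b r - ‖r‖ ^ 2 := by
      rw [← real_inner_self_eq_norm_sq, ← inner_sub_left, hr, sub_sub_cancel]
    have h4 : 2 * inner ℝ b r ≤ ‖b‖ ^ 2 + ‖r‖ ^ 2 := by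
      have := norm_sub_sq_real b r
      have := sq_nonneg ‖b - r‖
      linarith
    rw [h1, norm_add_sq_real, inner_smul_right, adjoint_inner_right, h3]
    have h5 := mul_le_mul_of_nonneg_left h4 hη
    push_cast
    nlinarith

lemma norm_landweber_le (hη : 0 ≤ η) (hA : η * ‖A‖ ^ 2 ≤ 1) (t : ℕ) :
    ‖landweber A b η t‖ ≤ √(η * t) * ‖b‖ := by
  refine le_of_sq_le_sq ?_ (by positivity)
  rw [mul_pow, Real.sq_sqrt (by positivity)]
  exact norm_landweber_sq_le b hη hA t

lemma sum_range_inv_sqrt_le (t : ℕ) :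
    ∑ k ∈ Finset.range t, 1 / √((k : ℝ) + 1) ≤ 2 * √(t : ℝ) := by
  induction t with
  | zero => simp
  | succ t ih =>
    rw [Finset.sum_range_succ]
    have h0 : (0 : ℝ) < √((t : ℝ) + 1) := by positivity
    have h1 : √(t : ℝ) ≤ √((t : ℝ) + 1) := Real.sqrt_le_sqrt (by linarith)
    have h2 := Real.sq_sqrt (show (0 : ℝ) ≤ t by positivity)
    have h3 := Real.sq_sqrt (show (0 : ℝ) ≤ (t : ℝ) + 1 by positivity)
    have : 1 / √((t : ℝ) + 1) ≤ 2 * (√((t : ℝ) + 1) - √(t : ℝ)) := by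
      rw [div_le_iff₀ h0]
      nlinarith [Real.sqrt_nonneg (t : ℝ)]
    push_cast
    linarith

lemma sum_range_inv_le (t : ℕ) :
    ∑ k ∈ Finset.range t, 1 / ((k : ℝ) + 1) ≤ 1 + Real.log t := by
  have := harmonic_le_one_add_log t
  simpa [harmonic] using this

/-- A linear recursion `D (t + 1) = B (D t) + w t` with `D 0 = 0`, solved and estimated in the
seminorm `‖C ·‖`. -/
lemma norm_map_recursion_le {V G : Type*} [NormedAddCommGroup V] [NormedSpace ℝ V]
    [NormedAddCommGroup G] [NormedSpace ℝ G] (C : V →L[ℝ] G) (B : V →L[ℝ] V) (D w : ℕ → V)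
    (h0 : D 0 = 0) (hD : ∀ t, D (t + 1) = B (D t) + w t)
    (t : ℕ) (c : ℕ → ℝ) (hc : ∀ s < t, ∀ k, ‖C ((B ^ k) (w s))‖ ≤ c k) :
    ‖C (D t)‖ ≤ ∑ k ∈ Finset.range t, c k := by
  have hsol : ∀ t, D t = ∑ s ∈ Finset.range t, (B ^ (t - 1 - s)) (w s) := by
    intro t
    induction t with
    | zero => simp [h0]
    | succ t ih =>
      rw [hD, ih, Finset.sum_range_succ, map_sum]
      congr 1
      · refine Finset.sum_congr rfl fun s hs => ?_
        have : t + 1 - 1 - s = (t - 1 - s) + 1 := by have := Finset.mem_range.1 hs; omega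
        rw [this, pow_succ_apply]
      · simp
  rw [hsol, map_sum, ← Finset.sum_range_reflect c]
  exact (norm_sum_le _ _).trans
    (Finset.sum_le_sum fun s hs => hc s (Finset.mem_range.1 hs) _)

variable {A' : E →L[ℝ] F}

/-- Perturbing the operator from `A` to `A'` perturbs the Landweber recursion by a source with one
part of size `‖A' - A‖ ‖b‖` and one part in the range of `A'*`, on which the iteration is
smoothing. -/
lemma landweber_sub_succ (t : ℕ) :
    landweber A' b η (t + 1) - landweber A b η (t + 1) =
      stepOp A' η (landweber A' b η t - landweber A b η t) +
        (η • (A' - A).adjoint (b - A (landweber A b η t)) +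
          η • A'.adjoint (-((A' - A) (landweber A b η t)))) := by
  simp only [landweber, stepOp_apply, map_sub, sub_apply, map_neg, smul_sub, smul_neg]
  abel

lemma norm_adjoint_sub_residual_le (hη : 0 ≤ η) (hA : η * ‖A‖ ^ 2 ≤ 1) (t : ℕ) :
    ‖(A' - A).adjoint (b - A (landweber A b η t))‖ ≤ ‖A' - A‖ * ‖b‖ := by
  refine (le_opNorm _ _).trans ?_
  rw [LinearIsometryEquiv.norm_map]
  gcongr
  exact norm_residual_landweber_le b hη hA t

lemma norm_sub_landweber_le (hη : 0 ≤ η) (hA : η * ‖A‖ ^ 2 ≤ 1) {t T : ℕ} (ht : t ≤ T) :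
    ‖-((A' - A) (landweber A b η t))‖ ≤ ‖A' - A‖ * (√(η * T) * ‖b‖) := by
  rw [norm_neg]
  refine (le_opNorm _ _).trans ?_
  gcongr
  refine (norm_landweber_le b hη hA t).trans ?_
  gcongr

lemma norm_landweber_sub_le (hη : 0 < η) (hA : η * ‖A‖ ^ 2 ≤ 1) (hA' : η * ‖A'‖ ^ 2 ≤ 1)
    {t T : ℕ} (ht : t ≤ T) :
    ‖landweber A' b η t - landweber A b η t‖ ≤ 3 * (η * T) * ‖A' - A‖ * ‖b‖ := by
  have h := norm_map_recursion_le (1 : E →L[ℝ] E) (stepOp A' η)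
    (fun t => landweber A' b η t - landweber A b η t) _ (by simp [landweber])
    (landweber_sub_succ b) t
    (fun k => η * (‖A' - A‖ * ‖b‖) +
      √η * (‖A' - A‖ * (√(η * T) * ‖b‖)) * (1 / √((k : ℝ) + 1))) (by
      intro s hs k
      rw [map_add, map_smul, map_smul]
      refine (norm_add_le (η • _) (η • _)).trans ?_
      rw [norm_smul, norm_smul, Real.norm_of_nonneg hη.le]
      gcongr ?_ + ?_
      · gcongr
        exact (norm_stepOp_pow_le hη.le hA' _ _).trans (norm_adjoint_sub_residual_le b hη.le hA s)
      · calc _ ≤ η * (‖A' - A‖ * (√(η * T) * ‖b‖) / √(η * (k + 1))) := by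
              gcongr
              refine (norm_stepOp_pow_adjoint_le hη hA' _ _).trans ?_
              gcongr
              exact norm_sub_landweber_le b hη.le hA (hs.le.trans ht)
          _ = _ := by
              have h3 := Real.sq_sqrt hη.le
              rw [Real.sqrt_mul hη.le (k + 1)]
              have : √η ≠ 0 := by positivity
              field_simp
              linear_combination -‖A' - A‖ * √(η * T) * ‖b‖ * h3)
  rw [Finset.sum_add_distrib, Finset.sum_const, Finset.card_range, nsmul_eq_mul,
    ← Finset.mul_sum] at h
  have ht' : (t : ℝ) ≤ T := by exact_mod_cast ht
  calc _ ≤ _ := h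
    _ ≤ T * (η * (‖A' - A‖ * ‖b‖)) +
        √η * (‖A' - A‖ * (√(η * T) * ‖b‖)) * (2 * √(T : ℝ)) := by
        refine add_le_add (by gcongr) (mul_le_mul_of_nonneg_left ?_ (by positivity))
        exact (sum_range_inv_sqrt_le t).trans (by gcongr)
    _ = _ := by
        rw [Real.sqrt_mul hη.le]
        have h3 := Real.sq_sqrt hη.le
        have h4 := Real.sq_sqrt (show (0 : ℝ) ≤ T by positivity)
        linear_combination 2 * ‖A' - A‖ * ‖b‖ * √(T : ℝ) ^ 2 * h3 + 2 * ‖A' - A‖ * ‖b‖ * η * h4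

lemma one_le_log_of_three_le {T : ℕ} (hT : 3 ≤ T) : 1 ≤ Real.log T := by
  have hT' : (3 : ℝ) ≤ T := by exact_mod_cast hT
  rw [Real.le_log_iff_exp_le (by linarith)]
  linarith [Real.exp_one_lt_d9]

/-- The logarithm comes from the harmonic sum of the bounds on `A' (1 - η A'* A') ^ k A'*`. -/
lemma norm_map_landweber_sub_le (hη : 0 < η) (hA : η * ‖A‖ ^ 2 ≤ 1) (hA' : η * ‖A'‖ ^ 2 ≤ 1)
    {t T : ℕ} (hT : 3 ≤ T) (ht : t ≤ T) :
    ‖A' (landweber A' b η t - landweber A b η t)‖ ≤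
      6 * Real.log T * √(η * T) * ‖A' - A‖ * ‖b‖ := by
  have h := norm_map_recursion_le A' (stepOp A' η)
    (fun t => landweber A' b η t - landweber A b η t) _ (by simp [landweber])
    (landweber_sub_succ b) t
    (fun k => √η * (‖A' - A‖ * ‖b‖) * (1 / √((k : ℝ) + 1)) +
      2 * (‖A' - A‖ * (√(η * T) * ‖b‖)) * (1 / ((k : ℝ) + 1))) (by
      intro s hs k
      rw [map_add, map_add, map_smul, map_smul, map_smul, map_smul]
      refine (norm_add_le _ _).trans ?_
      rw [norm_smul, norm_smul, Real.norm_of_nonneg hη.le]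
      gcongr ?_ + ?_
      · calc _ ≤ η * (‖A' - A‖ * ‖b‖ / √(η * (k + 1))) := by
              gcongr
              refine (norm_map_stepOp_pow_le hη hA' _ _).trans ?_
              gcongr
              exact norm_adjoint_sub_residual_le b hη.le hA s
          _ = _ := by
              have h3 := Real.sq_sqrt hη.le
              rw [Real.sqrt_mul hη.le (k + 1)]
              have : √η ≠ 0 := by positivity
              field_simp
              linear_combination -‖A' - A‖ * ‖b‖ * h3
      · calc _ ≤ η * (2 * (‖A' - A‖ * (√(η * T) * ‖b‖)) / (η * (k + 1))) := by
              gcongr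
              refine (norm_map_stepOp_pow_adjoint_le hη hA' _ _).trans ?_
              gcongr
              exact norm_sub_landweber_le b hη.le hA (hs.le.trans ht)
          _ = _ := by field_simp)
  rw [Finset.sum_add_distrib, ← Finset.mul_sum, ← Finset.mul_sum] at h
  have ht' : (t : ℝ) ≤ T := by exact_mod_cast ht
  have hlog : Real.log t ≤ Real.log T := by
    rcases Nat.eq_zero_or_pos t with rfl | h0
    · simpa using (zero_le_one.trans (one_le_log_of_three_le hT))
    · exact Real.log_le_log (by exact_mod_cast h0) ht'
  have h1 := one_le_log_of_three_le hT
  calc _ ≤ _ := h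
    _ ≤ √η * (‖A' - A‖ * ‖b‖) * (2 * √(T : ℝ)) +
        2 * (‖A' - A‖ * (√(η * T) * ‖b‖)) * (1 + Real.log T) := by
        gcongr
        · exact (sum_range_inv_sqrt_le t).trans (by gcongr)
        · exact (sum_range_inv_le t).trans (by gcongr)
    _ = (4 + 2 * Real.log T) * (√(η * T) * ‖A' - A‖ * ‖b‖) := by
        rw [Real.sqrt_mul hη.le]
        ring
    _ ≤ (6 * Real.log T) * (√(η * T) * ‖A' - A‖ * ‖b‖) := by
        gcongr
        linarith
    _ = _ := by ring

end Landweber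

/-! ### Sums of independent centred vectors in a Hilbert space -/

section Concentration

variable {W : Type*} [NormedAddCommGroup W] [InnerProductSpace ℝ W]

/-- `u ↦ cosh √u` is convex on `[0, ∞)`, as a power series with nonnegative coefficients, so that
it lies below its chord between `(a - b)²` and `(a + b)²`. -/
lemma cosh_le_chord {a b c x : ℝ} (hc : |c| ≤ 1) (hx : x ^ 2 = a ^ 2 + b ^ 2 + 2 * (c * (a * b))) :
    Real.cosh x ≤ Real.cosh a * Real.cosh b + c * (Real.sinh a * Real.sinh b) := by
  obtain ⟨hc1, hc2⟩ := abs_le.1 hc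
  have h : Real.cosh x ≤ (1 + c) / 2 * Real.cosh (a + b) + (1 - c) / 2 * Real.cosh (a - b) := by
    refine hasSum_le (fun k => ?_) (Real.hasSum_cosh x)
      (((Real.hasSum_cosh (a + b)).mul_left ((1 + c) / 2)).add
        ((Real.hasSum_cosh (a - b)).mul_left ((1 - c) / 2)))
    have h1 := (convexOn_pow (𝕜 := ℝ) k).2
      (Set.mem_Ici.2 (sq_nonneg (a + b))) (Set.mem_Ici.2 (sq_nonneg (a - b)))
      (show 0 ≤ (1 + c) / 2 by linarith) (show 0 ≤ (1 - c) / 2 by linarith) (by ring)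
    simp only [smul_eq_mul] at h1
    have h2 : (1 + c) / 2 * (a + b) ^ 2 + (1 - c) / 2 * (a - b) ^ 2 = x ^ 2 := by
      rw [hx]; ring
    rw [h2] at h1
    simp only [pow_mul]
    calc _ ≤ ((1 + c) / 2 * ((a + b) ^ 2) ^ k + (1 - c) / 2 * ((a - b) ^ 2) ^ k) /
          ((2 * k).factorial : ℝ) := by gcongr
      _ = _ := by ring
  rw [Real.cosh_add, Real.cosh_sub] at h
  linarith

/-- The one-step estimate behind Pinelis' inequality; its last term is linear in `y`, and so
vanishes on average for a centred random vector `y`. -/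
lemma cosh_norm_add_le (x : W) {y : W} (hy : ‖y‖ ≤ 1) :
    Real.cosh ‖x + y‖ ≤
      Real.cosh ‖x‖ * (1 + ‖y‖ ^ 2) + inner ℝ ((Real.sinh ‖x‖ / ‖x‖) • x) y := by
  set c : ℝ := inner ℝ x y / (‖x‖ * ‖y‖) with hcdef
  have hc : |c| ≤ 1 := abs_real_inner_div_norm_mul_norm_le_one x y
  have hin : inner ℝ x y = c * (‖x‖ * ‖y‖) := by
    rcases eq_or_ne (‖x‖ * ‖y‖) 0 with h0 | h0
    · have := abs_real_inner_le_norm x y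
      rw [h0] at this ⊢
      simpa using this
    · rw [hcdef, div_mul_cancel₀ _ h0]
  have h1 := cosh_le_chord (a := ‖x‖) (b := ‖y‖) (x := ‖x + y‖) hc (by rw [norm_add_sq_real, hin]; ring)
  have h2 : inner ℝ ((Real.sinh ‖x‖ / ‖x‖) • x) y = c * (Real.sinh ‖x‖ * ‖y‖) := by
    rw [real_inner_smul_left, hin]
    rcases eq_or_ne ‖x‖ 0 with h0 | h0
    · simp [h0]
    · field_simp
  have h3 : Real.cosh ‖y‖ + Real.sinh ‖y‖ ≤ 1 + ‖y‖ + ‖y‖ ^ 2 := by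
    rw [Real.cosh_add_sinh]
    have := Real.abs_exp_sub_one_sub_id_le (x := ‖y‖) (by rwa [abs_of_nonneg (norm_nonneg _)])
    linarith [(abs_le.1 this).2]
  have h4 : ‖y‖ ≤ Real.sinh ‖y‖ := Real.self_le_sinh_iff.2 (norm_nonneg _)
  have h5 : c * Real.sinh ‖x‖ ≤ Real.cosh ‖x‖ := by
    have : 0 ≤ Real.sinh ‖x‖ := Real.sinh_nonneg_iff.2 (norm_nonneg _)
    nlinarith [(abs_le.1 hc).2, Real.sinh_lt_cosh ‖x‖]
  have h6 := Real.cosh_pos ‖x‖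
  rw [h2]
  nlinarith [mul_le_mul_of_nonneg_right h5 (sub_nonneg.2 h4), mul_le_mul_of_nonneg_left h3 h6.le]

variable {Ω : Type*} [MeasurableSpace Ω] {P : Measure Ω} [IsProbabilityMeasure P]

/-- Sums over an i.i.d. sample, one summand at a time: an affine bound for adding one independent
summand iterates. -/
lemma lintegral_pi_sum_le {W : Type*} [NormedAddCommGroup W] {Y : Ω → W} (hY : StronglyMeasurable Y) {φ : W → ENNReal}
    (hφ : Continuous φ) {c d : ENNReal} (hc : c ≠ ⊤)
    (hstep : ∀ a, ∫⁻ ω, φ (a + Y ω) ∂P ≤ c * φ a + d) (n : ℕ) :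
    ∫⁻ z, φ (∑ j, Y (z j)) ∂(Measure.pi fun _ : Fin n => P) ≤
      (fun t => c * t + d)^[n] (φ 0) := by
  induction n with
  | zero => simp
  | succ n ih =>
    have hmp := (measurePreserving_piFinSuccAbove (fun _ : Fin (n + 1) => P) 0).symm
    rw [← hmp.lintegral_comp_emb (MeasurableEquiv.measurableEmbedding _)]
    have hsum : StronglyMeasurable fun p : Ω × (Fin n → Ω) => (∑ j, Y (p.2 j)) + Y p.1 := by
      refine StronglyMeasurable.add ?_ (hY.comp_measurable measurable_fst)
      refine Finset.stronglyMeasurable_fun_sum _ fun j _ => hY.comp_measurable ?_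
      exact (measurable_pi_apply j).comp measurable_snd
    have heq : ∀ p : Ω × (Fin n → Ω),
        φ (∑ j, Y ((MeasurableEquiv.piFinSuccAbove (fun _ : Fin (n + 1) => Ω) 0).symm p j)) =
          φ ((∑ j, Y (p.2 j)) + Y p.1) := by
      intro p
      rw [Fin.sum_univ_succ, add_comm]
      simp [MeasurableEquiv.piFinSuccAbove]
    simp_rw [heq]
    rw [lintegral_prod_symm _ (hφ.comp_stronglyMeasurable hsum).measurable.aemeasurable,
      Function.iterate_succ_apply']
    calc _ ≤ ∫⁻ z, (c * φ (∑ j, Y (z j)) + d) ∂(Measure.pi fun _ : Fin n => P) :=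
          lintegral_mono fun z => hstep _
      _ = c * ∫⁻ z, φ (∑ j, Y (z j)) ∂(Measure.pi fun _ : Fin n => P) + d := by
          rw [lintegral_add_right _ measurable_const, lintegral_const_mul' _ _ hc]
          simp
      _ ≤ _ := by gcongr

lemma lintegral_norm_sum_sq_le {Y : Ω → W} [CompleteSpace W] (hY : StronglyMeasurable Y) {c : ℝ}
    (hb : ∀ ω, ‖Y ω‖ ≤ c) (h0 : ∫ ω, Y ω ∂P = 0) (n : ℕ) :
    ∫⁻ z, ENNReal.ofReal (‖∑ j, Y (z j)‖ ^ 2) ∂(Measure.pi fun _ : Fin n => P) ≤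
      n * ENNReal.ofReal (∫ ω, ‖Y ω‖ ^ 2 ∂P) := by
  have hint : Integrable Y P := .of_bound hY.aestronglyMeasurable c (ae_of_all _ hb)
  have hint2 : Integrable (fun ω => ‖Y ω‖ ^ 2) P :=
    .of_bound (hY.norm.pow 2).aestronglyMeasurable (c ^ 2) (ae_of_all _ fun ω => by
      rw [Real.norm_of_nonneg (by positivity)]
      exact pow_le_pow_left₀ (norm_nonneg _) (hb ω) 2)
  refine (lintegral_pi_sum_le hY (φ := fun w => ENNReal.ofReal (‖w‖ ^ 2))
    (c := 1) (d := ENNReal.ofReal (∫ ω, ‖Y ω‖ ^ 2 ∂P)) 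
    (ENNReal.continuous_ofReal.comp (by fun_prop)) (by simp) (fun a => ?_)
    n).trans_eq ?_
  · have hint3 : Integrable (fun ω => ‖a‖ ^ 2 + 2 * inner ℝ a (Y ω)) P :=
      (integrable_const _).add ((hint.const_inner a).const_mul 2)
    have hint4 : Integrable (fun ω => ‖a‖ ^ 2 + 2 * inner ℝ a (Y ω) + ‖Y ω‖ ^ 2) P :=
      hint3.add hint2
    simp_rw [norm_add_sq_real]
    rw [← ofReal_integral_eq_lintegral_ofReal hint4
      (ae_of_all _ fun ω => by
        change 0 ≤ ‖a‖ ^ 2 + 2 * inner ℝ a (Y ω) + ‖Y ω‖ ^ 2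
        rw [← norm_add_sq_real]; positivity),
      integral_add hint3 hint2, integral_add (integrable_const _)
      ((hint.const_inner a).const_mul 2), integral_const_mul, integral_inner hint, h0]
    simp [ENNReal.ofReal_add (sq_nonneg ‖a‖) (integral_nonneg fun ω => sq_nonneg ‖Y ω‖)]
  · generalize ENNReal.ofReal (∫ ω, ‖Y ω‖ ^ 2 ∂P) = d
    simp only [one_mul, norm_zero]
    induction n with
    | zero => simp
    | succ n ih => rw [Function.iterate_succ_apply', ih]; push_cast; ring

/-- Pinelis' inequality: the exponential moment of a sum of i.i.d. bounded centred vectors is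
controlled without any dependence on the dimension. -/
lemma lintegral_cosh_norm_sum_le {Y : Ω → W} [CompleteSpace W] (hY : StronglyMeasurable Y)
    (hb : ∀ ω, ‖Y ω‖ ≤ 1) (h0 : ∫ ω, Y ω ∂P = 0) (n : ℕ) :
    ∫⁻ z, ENNReal.ofReal (Real.cosh ‖∑ j, Y (z j)‖) ∂(Measure.pi fun _ : Fin n => P) ≤
      ENNReal.ofReal (Real.exp (n * ∫ ω, ‖Y ω‖ ^ 2 ∂P)) := by
  have hint : Integrable Y P := .of_bound hY.aestronglyMeasurable 1 (ae_of_all _ hb)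
  have hint2 : Integrable (fun ω => ‖Y ω‖ ^ 2) P :=
    .of_bound (hY.norm.pow 2).aestronglyMeasurable 1 (ae_of_all _ fun ω => by
      rw [Real.norm_of_nonneg (by positivity)]
      exact pow_le_one₀ (norm_nonneg _) (hb ω))
  have hcosh : Continuous fun w : W => ENNReal.ofReal (Real.cosh ‖w‖) :=
    ENNReal.continuous_ofReal.comp (Real.continuous_cosh.comp continuous_norm)
  refine (lintegral_pi_sum_le hY (φ := fun w => ENNReal.ofReal (Real.cosh ‖w‖))
    (c := ENNReal.ofReal (Real.exp (∫ ω, ‖Y ω‖ ^ 2 ∂P))) (d := 0) hcosh (by simp) (fun a => ?_)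
    n).trans_eq ?_
  · have hI1 : Integrable (fun ω => Real.cosh ‖a‖ * (1 + ‖Y ω‖ ^ 2)) P :=
      ((integrable_const _).add hint2).const_mul _
    have hI2 := hint.const_inner (𝕜 := ℝ) ((Real.sinh ‖a‖ / ‖a‖) • a)
    have hI3 : Integrable (fun ω => Real.cosh ‖a‖ * (1 + ‖Y ω‖ ^ 2) +
        inner ℝ ((Real.sinh ‖a‖ / ‖a‖) • a) (Y ω)) P := hI1.add hI2
    calc _ ≤ ∫⁻ ω, ENNReal.ofReal (Real.cosh ‖a‖ * (1 + ‖Y ω‖ ^ 2) +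
          inner ℝ ((Real.sinh ‖a‖ / ‖a‖) • a) (Y ω)) ∂P :=
          lintegral_mono fun ω => ENNReal.ofReal_le_ofReal (cosh_norm_add_le a (hb ω))
      _ = ENNReal.ofReal (Real.cosh ‖a‖ * (1 + ∫ ω, ‖Y ω‖ ^ 2 ∂P)) := by
          rw [← ofReal_integral_eq_lintegral_ofReal hI3
            (ae_of_all _ fun ω => (Real.cosh_pos _).le.trans (cosh_norm_add_le a (hb ω))),
            integral_add hI1 hI2, integral_inner hint, h0, integral_const_mul,
            integral_add (integrable_const _) hint2]
          simp
      _ ≤ ENNReal.ofReal (Real.exp (∫ ω, ‖Y ω‖ ^ 2 ∂P) * Real.cosh ‖a‖) := by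
          rw [mul_comm]
          refine ENNReal.ofReal_le_ofReal (mul_le_mul_of_nonneg_right ?_ (Real.cosh_pos _).le)
          rw [add_comm]
          exact Real.add_one_le_exp _
      _ = _ := by rw [ENNReal.ofReal_mul (Real.exp_nonneg _), add_zero]
  · rw [Real.exp_nat_mul, ENNReal.ofReal_pow (Real.exp_nonneg _)]
    generalize ENNReal.ofReal (Real.exp (∫ ω, ‖Y ω‖ ^ 2 ∂P)) = c
    simp only [add_zero, mul_left_iterate, norm_zero, Real.cosh_zero, ENNReal.ofReal_one, mul_one]

/-- A Bernstein-type tail bound for sums of i.i.d. bounded centred vectors. -/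
lemma measure_le_norm_sum_le {Y : Ω → W} [CompleteSpace W] (hY : StronglyMeasurable Y)
    (hb : ∀ ω, ‖Y ω‖ ≤ 1) (h0 : ∫ ω, Y ω ∂P = 0) (n : ℕ) (r : ℝ) :
    (Measure.pi fun _ : Fin n => P) {z | r ≤ ‖∑ j, Y (z j)‖} ≤
      ENNReal.ofReal (2 * Real.exp (n * (∫ ω, ‖Y ω‖ ^ 2 ∂P) - r)) := by
  have hsub : {z : Fin n → Ω | r ≤ ‖∑ j, Y (z j)‖} ⊆
      {z | ENNReal.ofReal (Real.exp r / 2) ≤ ENNReal.ofReal (Real.cosh ‖∑ j, Y (z j)‖)} := by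
    intro z hz
    refine ENNReal.ofReal_le_ofReal ?_
    have h1 := Real.exp_le_exp.2 hz
    rw [Real.cosh_eq]
    linarith [Real.exp_pos (-‖∑ j, Y (z j)‖)]
  have hsum : StronglyMeasurable fun z : Fin n → Ω => ∑ j, Y (z j) :=
    Finset.stronglyMeasurable_fun_sum _ fun j _ => hY.comp_measurable (measurable_pi_apply j)
  have hmeas : Measurable fun z : Fin n → Ω => ENNReal.ofReal (Real.cosh ‖∑ j, Y (z j)‖) :=
    (ENNReal.continuous_ofReal.comp Real.continuous_cosh).measurable.comp hsum.norm.measurable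
  have hpos : 0 < Real.exp r / 2 := by positivity
  refine (measure_mono hsub).trans ((meas_ge_le_lintegral_div hmeas.aemeasurable
    (by simpa using hpos) ENNReal.ofReal_ne_top).trans ?_)
  refine (ENNReal.div_le_div_right (lintegral_cosh_norm_sum_le hY hb h0 n) _).trans_eq ?_
  rw [← ENNReal.ofReal_div_of_pos hpos, Real.exp_sub]
  congr 1
  field_simp

end Concentration

/-! ### Whitening and the effective dimension -/

section Whitening

open ContinuousLinearMap

variable {H F : Type*} [NormedAddCommGroup H] [InnerProductSpace ℝ H] [CompleteSpace H]
  [NormedAddCommGroup F] [InnerProductSpace ℝ F] [CompleteSpace F]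

lemma isUnit_adjoint_comp_self_add (S : H →L[ℝ] F) {lam : ℝ} (hlam : 0 < lam) :
    IsUnit (S.adjoint ∘L S + lam • (1 : H →L[ℝ] H)) := by
  refine isUnit_of_forall_le_norm_inner_map _ (c := ⟨lam, hlam.le⟩) hlam fun x => ?_
  refine le_trans ?_ (le_abs_self _)
  change ‖x‖ ^ 2 * lam ≤ inner ℝ (S.adjoint (S x) + lam • x) x
  rw [inner_add_left, adjoint_inner_left, real_inner_smul_left, real_inner_self_eq_norm_sq,
    real_inner_self_eq_norm_sq]
  linarith [sq_nonneg ‖S x‖]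

/-- The resolvent `(S* S + lam)⁻¹`. -/
noncomputable def resolvent (S : H →L[ℝ] F) (lam : ℝ) : H →L[ℝ] H :=
  Ring.inverse (S.adjoint ∘L S + lam • (1 : H →L[ℝ] H))

lemma resolvent_spec (S : H →L[ℝ] F) {lam : ℝ} (hlam : 0 < lam) (x : H) :
    S.adjoint (S (resolvent S lam x)) + lam • resolvent S lam x = x :=
  congrArg (fun B : H →L[ℝ] H => B x)
    (Ring.mul_inverse_cancel _ (isUnit_adjoint_comp_self_add S hlam))

/-- The map `h ↦ (S h, √lam h)`, whose Gram operator is `S* S + lam`. -/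
noncomputable def augmented (S : H →L[ℝ] F) (lam : ℝ) : H →L[ℝ] WithLp 2 (F × H) :=
  ((WithLp.prodContinuousLinearEquiv 2 ℝ F H).symm : (F × H) →L[ℝ] WithLp 2 (F × H)) ∘L
    S.prod (√lam • (1 : H →L[ℝ] H))

lemma inner_augmented {H F : Type*} [NormedAddCommGroup H] [InnerProductSpace ℝ H]
    [NormedAddCommGroup F] [InnerProductSpace ℝ F] (S : H →L[ℝ] F) {lam : ℝ} (hlam : 0 ≤ lam) (x y : H) :
    inner ℝ (augmented S lam x) (augmented S lam y) =
      inner ℝ (S x) (S y) + lam * inner ℝ x y := by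
  change inner ℝ (S x) (S y) + inner ℝ (√lam • x) (√lam • y) = _
  rw [real_inner_smul_left, real_inner_smul_right, ← mul_assoc, Real.mul_self_sqrt hlam]

lemma norm_augmented_sq {H F : Type*} [NormedAddCommGroup H] [InnerProductSpace ℝ H]
    [NormedAddCommGroup F] [InnerProductSpace ℝ F] (S : H →L[ℝ] F) {lam : ℝ} (hlam : 0 ≤ lam) (x : H) :
    ‖augmented S lam x‖ ^ 2 = ‖S x‖ ^ 2 + lam * ‖x‖ ^ 2 := by
  simp only [← real_inner_self_eq_norm_sq, inner_augmented S hlam]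

/-- The whitening map. It plays the part of `(S* S + lam)^{-1/2}`, without a square root of an
operator: its Gram operator is `(S* S + lam)⁻¹`. -/
noncomputable def whiten (S : H →L[ℝ] F) (lam : ℝ) : H →L[ℝ] WithLp 2 (F × H) :=
  augmented S lam ∘L resolvent S lam

lemma inner_whiten_augmented (S : H →L[ℝ] F) {lam : ℝ} (hlam : 0 < lam) (x h : H) :
    inner ℝ (whiten S lam x) (augmented S lam h) = inner ℝ x h := by
  conv_rhs => rw [← resolvent_spec S hlam x]
  rw [inner_add_left, adjoint_inner_left, real_inner_smul_left]
  exact inner_augmented S hlam.le _ _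

lemma norm_whiten_sq_eq_inner (S : H →L[ℝ] F) {lam : ℝ} (hlam : 0 < lam) (x : H) :
    ‖whiten S lam x‖ ^ 2 = inner ℝ x (resolvent S lam x) := by
  rw [← inner_whiten_augmented S hlam, ← real_inner_self_eq_norm_sq]
  rfl

lemma norm_whiten_sq_le (S : H →L[ℝ] F) {lam : ℝ} (hlam : 0 < lam) (x : H) :
    ‖whiten S lam x‖ ^ 2 ≤ ‖x‖ ^ 2 / lam := by
  have h1 : lam * ‖resolvent S lam x‖ ^ 2 ≤ ‖whiten S lam x‖ ^ 2 := by
    have := norm_augmented_sq S hlam.le (resolvent S lam x)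
    change lam * ‖resolvent S lam x‖ ^ 2 ≤ ‖augmented S lam (resolvent S lam x)‖ ^ 2
    rw [this]
    linarith [sq_nonneg ‖S (resolvent S lam x)‖]
  have h2 := norm_whiten_sq_eq_inner S hlam x
  have h3 := real_inner_le_norm x (resolvent S lam x)
  rw [le_div_iff₀ hlam]
  nlinarith [sq_nonneg (‖x‖ - lam * ‖resolvent S lam x‖)]

lemma norm_whiten_anti (S : H →L[ℝ] F) {lam lam₁ : ℝ} (hlam : 0 < lam) (hle : lam ≤ lam₁) (x : H) :
    ‖whiten S lam₁ x‖ ≤ ‖whiten S lam x‖ := by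
  have hlam₁ := hlam.trans_le hle
  set h := resolvent S lam₁ x
  have h1 : ‖augmented S lam h‖ ≤ ‖whiten S lam₁ x‖ := by
    refine le_of_sq_le_sq ?_ (norm_nonneg _)
    change _ ≤ ‖augmented S lam₁ h‖ ^ 2
    rw [norm_augmented_sq S hlam.le, norm_augmented_sq S hlam₁.le]
    gcongr
  have h2 : ‖whiten S lam₁ x‖ ^ 2 ≤ ‖whiten S lam x‖ * ‖whiten S lam₁ x‖ := by
    rw [norm_whiten_sq_eq_inner S hlam₁, ← inner_whiten_augmented S hlam]
    exact (real_inner_le_norm _ _).trans (by gcongr)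
  rcases (norm_nonneg (whiten S lam₁ x)).eq_or_lt with h0 | h0
  · rw [← h0]; positivity
  · rw [sq] at h2
    exact le_of_mul_le_mul_right h2 h0

/-- The operator `L (L + lam)⁻¹` of the effective dimension, for `L = S S*`, is the Gram operator of
`whiten S lam ∘ S*`. -/
lemma inner_mul_inverse_eq (S : H →L[ℝ] F) {lam : ℝ} (hlam : 0 < lam) (e : F) :
    inner ℝ e (((S ∘L S.adjoint) * Ring.inverse (S ∘L S.adjoint + lam • (1 : F →L[ℝ] F))) e) =
      ‖whiten S lam (S.adjoint e)‖ ^ 2 := by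
  have hu : IsUnit (S ∘L S.adjoint + lam • (1 : F →L[ℝ] F)) := by
    simpa using isUnit_adjoint_comp_self_add S.adjoint hlam
  have hcomm : (S ∘L resolvent S lam ∘L S.adjoint) * (S ∘L S.adjoint + lam • (1 : F →L[ℝ] F)) =
      S ∘L S.adjoint := by
    ext e
    have hinv := congrArg (fun B : H →L[ℝ] H => B (S.adjoint e))
      (Ring.inverse_mul_cancel _ (isUnit_adjoint_comp_self_add S hlam))
    change resolvent S lam (S.adjoint (S (S.adjoint e)) + lam • S.adjoint e) = S.adjoint e at hinv
    change S (resolvent S lam (S.adjoint (S (S.adjoint e) + lam • e))) = S (S.adjoint e)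
    rw [map_add, map_smul, hinv]
  have heq : (S ∘L S.adjoint) * Ring.inverse (S ∘L S.adjoint + lam • (1 : F →L[ℝ] F)) =
      S ∘L resolvent S lam ∘L S.adjoint := by
    calc _ = (S ∘L resolvent S lam ∘L S.adjoint) * (S ∘L S.adjoint + lam • (1 : F →L[ℝ] F)) *
          Ring.inverse (S ∘L S.adjoint + lam • (1 : F →L[ℝ] F)) := by rw [hcomm]
      _ = _ := Ring.mul_inverse_cancel_right _ _ hu
  rw [heq, norm_whiten_sq_eq_inner S hlam]
  change inner ℝ e (S (resolvent S lam (S.adjoint e))) = _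
  rw [adjoint_inner_left]

end Whitening

section Trace

open ContinuousLinearMap

lemma countable_hilbertBasis {ι V : Type*} [NormedAddCommGroup V] [InnerProductSpace ℝ V]
    [TopologicalSpace.SeparableSpace V] (b : HilbertBasis ι ℝ V) : Countable ι := by
  refine Pairwise.countable_of_isOpen_disjoint (s := fun i => Metric.ball (b i) (1 / 2))
    (fun i j hij => ?_) (fun _ => Metric.isOpen_ball)
    fun i => ⟨b i, Metric.mem_ball_self (by norm_num)⟩
  refine Metric.ball_disjoint_ball ?_
  have h := norm_sub_sq_real (b i) (b j)
  rw [b.orthonormal.2 hij, b.orthonormal.1 i, b.orthonormal.1 j] at h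
  rw [dist_eq_norm]
  nlinarith [norm_nonneg (b i - b j)]

lemma tsum_ofReal_inner_sq {ι V : Type*} [NormedAddCommGroup V] [InnerProductSpace ℝ V]
    (b : HilbertBasis ι ℝ V) (x : V) :
    ∑' i, ENNReal.ofReal (inner ℝ (b i) x ^ 2) = ENNReal.ofReal (‖x‖ ^ 2) := by
  have h := b.hasSum_inner_mul_inner x x
  have heq : (fun i => inner ℝ x (b i) * inner ℝ (b i) x) = fun i => inner ℝ (b i) x ^ 2 := by
    ext i; rw [real_inner_comm, sq]
  rw [heq, real_inner_self_eq_norm_sq] at h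
  rw [← ENNReal.ofReal_tsum_of_nonneg (fun i => sq_nonneg _) h.summable, h.tsum_eq]

variable {H V Z : Type*} [NormedAddCommGroup H] [InnerProductSpace ℝ H] [CompleteSpace H]
  [NormedAddCommGroup V] [InnerProductSpace ℝ V] [CompleteSpace V]
  [MeasurableSpace Z] {ν : Measure Z} {S : H →L[ℝ] Lp ℝ 2 ν} {k : Z → H}

lemma ofReal_norm_sq_eq_lintegral {H : Type*} [NormedAddCommGroup H] [InnerProductSpace ℝ H]
    {S : H →L[ℝ] Lp ℝ 2 ν} {k : Z → H} (hS : ∀ f, S f =ᵐ[ν] fun z => inner ℝ (k z) f) (f : H) :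
    ENNReal.ofReal (‖S f‖ ^ 2) = ∫⁻ z, ENNReal.ofReal (inner ℝ (k z) f ^ 2) ∂ν := by
  rw [← real_inner_self_eq_norm_sq, L2.inner_def,
    ofReal_integral_eq_lintegral_ofReal (L2.integrable_inner _ _)
      (ae_of_all _ fun z => real_inner_self_nonneg)]
  refine lintegral_congr_ae ?_
  filter_upwards [hS f] with z hz
  rw [hz, real_inner_self_eq_norm_sq, Real.norm_eq_abs, sq_abs]

/-- The trace of the Gram operator of `B ∘ S*`, computed in the kernel sections `k z`. -/
lemma tsum_ofReal_norm_sq_eq_lintegral [TopologicalSpace.SeparableSpace V]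
    (hk : StronglyMeasurable k) (hS : ∀ f, S f =ᵐ[ν] fun z => inner ℝ (k z) f) (B : H →L[ℝ] V)
    {ι : Type*} (e : HilbertBasis ι ℝ (Lp ℝ 2 ν)) :
    ∑' i, ENNReal.ofReal (‖B (S.adjoint (e i))‖ ^ 2) =
      ∫⁻ z, ENNReal.ofReal (‖B (k z)‖ ^ 2) ∂ν := by
  obtain ⟨w, b, -⟩ := exists_hilbertBasis ℝ V
  have := countable_hilbertBasis b
  calc _ = ∑' i, ∑' l, ENNReal.ofReal (inner ℝ (e i) (S (B.adjoint (b l))) ^ 2) := by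
        refine tsum_congr fun i => ?_
        rw [← tsum_ofReal_inner_sq b]
        refine tsum_congr fun l => ?_
        rw [← adjoint_inner_left, ← adjoint_inner_left, real_inner_comm]
        simp
    _ = ∑' l, ∑' i, ENNReal.ofReal (inner ℝ (e i) (S (B.adjoint (b l))) ^ 2) := ENNReal.tsum_comm
    _ = ∑' l, ∫⁻ z, ENNReal.ofReal (inner ℝ (b l) (B (k z)) ^ 2) ∂ν := by
        refine tsum_congr fun l => ?_
        rw [tsum_ofReal_inner_sq e, ofReal_norm_sq_eq_lintegral hS]
        simp_rw [adjoint_inner_right, real_inner_comm]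
    _ = ∫⁻ z, ∑' l, ENNReal.ofReal (inner ℝ (b l) (B (k z)) ^ 2) ∂ν := by
        refine (lintegral_tsum fun l => ?_).symm
        have : StronglyMeasurable fun z => inner ℝ (b l) (B (k z)) :=
          ((innerSL ℝ (b l)).continuous.comp B.continuous).comp_stronglyMeasurable hk
        exact (this.measurable.pow_const 2).ennreal_ofReal.aemeasurable
    _ = _ := by simp_rw [tsum_ofReal_inner_sq b]

lemma effDim_nonneg {F : Type*} [NormedAddCommGroup F] [InnerProductSpace ℝ F] [CompleteSpace F]
    (S : H →L[ℝ] F) {lam : ℝ} (hlam : 0 < lam) : 0 ≤ effDim (S ∘L S.adjoint) lam :=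
  tsum_nonneg fun i => by
    rw [inner_mul_inverse_eq S hlam]
    positivity

lemma integral_norm_whiten_sq_eq_effDim [IsFiniteMeasure ν] [TopologicalSpace.SeparableSpace H]
    [TopologicalSpace.SeparableSpace (Lp ℝ 2 ν)]
    (hk : StronglyMeasurable k) (hS : ∀ f, S f =ᵐ[ν] fun z => inner ℝ (k z) f) {lam : ℝ}
    (hlam : 0 < lam) :
    ∫ z, ‖whiten S lam (k z)‖ ^ 2 ∂ν = effDim (intOp S) lam := by
  have : TopologicalSpace.SeparableSpace (WithLp 2 (Lp ℝ 2 ν × H)) :=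
    (WithLp.prodContinuousLinearEquiv 2 ℝ (Lp ℝ 2 ν) H).symm.surjective.denseRange.separableSpace
      (WithLp.prodContinuousLinearEquiv 2 ℝ (Lp ℝ 2 ν) H).symm.continuous
  have hm : StronglyMeasurable fun z => ‖whiten S lam (k z)‖ ^ 2 :=
    ((whiten S lam).continuous.comp_stronglyMeasurable hk).norm.pow 2
  rw [integral_eq_lintegral_of_nonneg_ae (ae_of_all _ fun z => sq_nonneg _)
    hm.aestronglyMeasurable, ← tsum_ofReal_norm_sq_eq_lintegral hk hS (whiten S lam)
    (exists_hilbertBasis ℝ (Lp ℝ 2 ν)).choose_spec.choose,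
    ENNReal.tsum_toReal_eq fun i => ENNReal.ofReal_ne_top]
  refine tsum_congr fun i => ?_
  rw [ENNReal.toReal_ofReal (by positivity), ← inner_mul_inverse_eq S hlam]
  rfl

end Trace

/-! ### The lower tail of the empirical covariance -/

section LowerTail

variable {Z : Type*} [MeasurableSpace Z] {ν : Measure Z} [IsProbabilityMeasure ν]

/-- A tail bound for sums of i.i.d. bounded vectors with a free scale parameter `s`. -/
lemma measure_le_norm_sum_sub_integral_le {W : Type*} [NormedAddCommGroup W]
    [InnerProductSpace ℝ W] [CompleteSpace W] {ψ : Z → W} (hψ : StronglyMeasurable ψ) {b v s : ℝ}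
    (hb : ∀ z, ‖ψ z‖ ≤ b) (hv : ∫ z, ‖ψ z‖ ^ 2 ∂ν ≤ v) (hs : 0 ≤ s) (hsb : s * (2 * b) ≤ 1)
    (n : ℕ) (r : ℝ) :
    (Measure.pi fun _ : Fin n => ν) {z | r ≤ ‖∑ j, (ψ (z j) - ∫ w, ψ w ∂ν)‖} ≤
      ENNReal.ofReal (2 * Real.exp (n * (s ^ 2 * v) - s * r)) := by
  have hint : Integrable ψ ν := .of_bound hψ.aestronglyMeasurable b (ae_of_all _ hb)
  have hint2 : Integrable (fun z => ‖ψ z‖ ^ 2) ν :=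
    .of_bound (hψ.norm.pow 2).aestronglyMeasurable (b ^ 2) (ae_of_all _ fun z => by
      rw [Real.norm_of_nonneg (by positivity)]
      exact pow_le_pow_left₀ (norm_nonneg _) (hb z) 2)
  set m := ∫ w, ψ w ∂ν
  have hm : ‖m‖ ≤ b := by
    refine (norm_integral_le_integral_norm _).trans ?_
    refine (integral_mono hint.norm (integrable_const b) hb).trans_eq ?_
    simp
  have hvar : ∫ z, ‖ψ z - m‖ ^ 2 ∂ν ≤ v := by
    have h1 : Integrable (fun z => ‖ψ z‖ ^ 2 - 2 * inner ℝ m (ψ z)) ν :=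
      hint2.sub ((hint.const_inner m).const_mul 2)
    simp_rw [norm_sub_sq_real, real_inner_comm m]
    rw [integral_add h1 (integrable_const _), integral_sub hint2
      ((hint.const_inner m).const_mul 2), integral_const_mul, integral_inner hint]
    simp only [integral_const, probReal_univ, smul_eq_mul, one_mul]
    rw [real_inner_self_eq_norm_sq]
    linarith [sq_nonneg ‖m‖]
  have hY : StronglyMeasurable fun z => s • (ψ z - m) :=
    (hψ.sub stronglyMeasurable_const).const_smul s
  have h := measure_le_norm_sum_le (P := ν) hY (fun z => by
      rw [norm_smul, Real.norm_of_nonneg hs]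
      refine le_trans ?_ hsb
      gcongr
      exact (norm_sub_le _ _).trans (by linarith [hb z])) (by
      rw [integral_smul, integral_sub hint (integrable_const _)]
      simp [m]) n (s * r)
  refine (measure_mono fun z hz => ?_).trans (h.trans (ENNReal.ofReal_le_ofReal ?_))
  · change s * r ≤ ‖∑ j, s • (ψ (z j) - m)‖
    rw [← Finset.smul_sum, norm_smul, Real.norm_of_nonneg hs]
    exact mul_le_mul_of_nonneg_left hz hs
  · simp_rw [norm_smul, mul_pow, Real.norm_of_nonneg hs]
    rw [integral_const_mul]
    gcongr

variable {H : Type*} [NormedAddCommGroup H] [InnerProductSpace ℝ H] [CompleteSpace H]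
  {S : H →L[ℝ] Lp ℝ 2 ν} {k : Z → H}

open scoped TensorProduct

/-- The tensor square `u ⊗ u`, in the completed Hilbert tensor product. The operator
`h ↦ ⟪u, h⟫ u` is represented by it as a Hilbert-Schmidt operator. -/
noncomputable def tensorSq {V : Type*} [NormedAddCommGroup V] [InnerProductSpace ℝ V] (u : V) :
    UniformSpace.Completion (V ⊗[ℝ] V) := ((u ⊗ₜ[ℝ] u : V ⊗[ℝ] V) : UniformSpace.Completion _)

lemma inner_tensorSq {V : Type*} [NormedAddCommGroup V] [InnerProductSpace ℝ V] (u w : V) :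
    inner ℝ (tensorSq u) (tensorSq w) = inner ℝ u w ^ 2 := by
  rw [tensorSq, tensorSq, UniformSpace.Completion.inner_coe, TensorProduct.inner_tmul, sq]

lemma norm_tensorSq {V : Type*} [NormedAddCommGroup V] [InnerProductSpace ℝ V] (u : V) :
    ‖tensorSq u‖ = ‖u‖ ^ 2 := by
  rw [tensorSq, UniformSpace.Completion.norm_coe, TensorProduct.norm_tmul, sq]

lemma continuous_tensorSq {V : Type*} [NormedAddCommGroup V] [InnerProductSpace ℝ V] :
    Continuous (tensorSq : V → _) :=
  (UniformSpace.Completion.continuous_coe _).comp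
    (TensorProduct.continuous_tmul.comp (continuous_id.prodMk continuous_id))

/-- If `lam₁` is large enough, the empirical covariance dominates half of the covariance up to a
regularization by `lam₁`. The whitened kernel sections are bounded by `κ² / lam₁` in square, and
their mean square is at most the effective dimension at any `lam ≤ lam₁`. -/
lemma measure_not_covariance_le [TopologicalSpace.SeparableSpace H]
    [TopologicalSpace.SeparableSpace (Lp ℝ 2 ν)] (hk : StronglyMeasurable k)
    (hS : ∀ f, S f =ᵐ[ν] fun z => inner ℝ (k z) f) {κ : ℝ} (hkκ : ∀ z, ‖k z‖ ≤ κ)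
    {lam lam₁ l : ℝ} {n : ℕ} (hn : 0 < n) (hlam : 0 < lam) (hle : lam ≤ lam₁) (hl : 0 ≤ l)
    (hlam₁ : 8 * κ ^ 2 * (1 + 2 * effDim (intOp S) lam) * l / n ≤ lam₁) :
    (Measure.pi fun _ : Fin n => ν)
      {z | ¬ ∀ h : H, ‖S h‖ ^ 2 ≤ 2 * (1 / n * ∑ j, inner ℝ (k (z j)) h ^ 2) + lam₁ * ‖h‖ ^ 2} ≤
      ENNReal.ofReal (2 * Real.exp (-l)) := by
  have hpos := hlam.trans_le hle
  have hn' : (0 : ℝ) < n := by exact_mod_cast hn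
  set N := effDim (intOp S) lam with hN
  have hN0 : 0 ≤ N := effDim_nonneg S hlam
  have hwm : StronglyMeasurable fun z => whiten S lam₁ (k z) :=
    (whiten S lam₁).continuous.comp_stronglyMeasurable hk
  set ψ := fun z => tensorSq (whiten S lam₁ (k z)) with hψdef
  have hψ : StronglyMeasurable ψ := continuous_tensorSq.comp_stronglyMeasurable hwm
  have hb1 : ∀ z, ‖whiten S lam₁ (k z)‖ ^ 2 ≤ κ ^ 2 / lam₁ := fun z => by
    refine (norm_whiten_sq_le S hpos _).trans ?_
    have := hkκ z
    gcongr
  have hb : ∀ z, ‖ψ z‖ ≤ κ ^ 2 / lam₁ := fun z => by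
    rw [hψdef, norm_tensorSq]; exact hb1 z
  have hv : ∫ z, ‖ψ z‖ ^ 2 ∂ν ≤ κ ^ 2 / lam₁ * N := by
    rw [hN, ← integral_norm_whiten_sq_eq_effDim hk hS hlam, ← integral_const_mul]
    have hwm' : StronglyMeasurable fun z => whiten S lam (k z) :=
      (whiten S lam).continuous.comp_stronglyMeasurable hk
    have hI1 : Integrable (fun z => ‖ψ z‖ ^ 2) ν :=
      .of_bound (hψ.norm.pow 2).aestronglyMeasurable ((κ ^ 2 / lam₁) ^ 2) (ae_of_all _ fun z => by
        rw [Real.norm_of_nonneg (by positivity)]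
        exact pow_le_pow_left₀ (norm_nonneg _) (hb z) 2)
    have hI2 : Integrable (fun z => ‖whiten S lam (k z)‖ ^ 2) ν :=
      .of_bound (hwm'.norm.pow 2).aestronglyMeasurable (κ ^ 2 / lam) (ae_of_all _ fun z => by
        rw [Real.norm_of_nonneg (by positivity)]
        refine (norm_whiten_sq_le S hlam _).trans ?_
        have := hkκ z
        gcongr)
    refine integral_mono hI1 (hI2.const_mul _) fun z => ?_
    · change ‖ψ z‖ ^ 2 ≤ κ ^ 2 / lam₁ * ‖whiten S lam (k z)‖ ^ 2
      rw [hψdef, norm_tensorSq, sq (‖whiten S lam₁ (k z)‖ ^ 2)]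
      have := norm_whiten_anti S hlam hle (k z)
      gcongr
      exact hb1 z
  have hcond : 8 * l * (κ ^ 2 / lam₁) * (1 + 2 * N) ≤ n := by
    rw [div_le_iff₀ hn'] at hlam₁
    have : 8 * l * (κ ^ 2 / lam₁) * (1 + 2 * N) = 8 * κ ^ 2 * (1 + 2 * N) * l / lam₁ := by ring
    rw [this, div_le_iff₀ hpos]
    linarith
  have hκl : 0 ≤ l * (κ ^ 2 / lam₁) := by positivity
  -- The scale `4 l / n` makes the variance term at most half of the gain `2 l` of the tail.
  have htail := measure_le_norm_sum_sub_integral_le (ν := ν) hψ hb hv (s := 4 * l / n)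
    (by positivity) (by
      rw [div_mul_eq_mul_div, div_le_one hn']
      nlinarith [mul_nonneg hκl hN0]) n (n / 2)
  refine (measure_mono fun z hz => ?_).trans (htail.trans (ENNReal.ofReal_le_ofReal ?_))
  · by_contra hlt
    refine hz fun h => ?_
    replace hlt : ‖∑ j, (ψ (z j) - ∫ w, ψ w ∂ν)‖ < n / 2 := not_le.1 hlt
    set q := augmented S lam₁ h
    have hψq : ∀ w, inner ℝ (tensorSq q) (ψ w) = inner ℝ (k w) h ^ 2 := fun w => by
      rw [real_inner_comm, hψdef, inner_tensorSq, inner_whiten_augmented S hpos]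
    have hmean : inner ℝ (tensorSq q) (∫ w, ψ w ∂ν) = ‖S h‖ ^ 2 := by
      rw [← integral_inner (.of_bound hψ.aestronglyMeasurable _ (ae_of_all _ hb))]
      simp_rw [hψq]
      have h2 := ofReal_norm_sq_eq_lintegral hS h
      have hm : StronglyMeasurable fun z => inner ℝ (k z) h ^ 2 :=
        (hk.inner stronglyMeasurable_const).pow 2
      rw [integral_eq_lintegral_of_nonneg_ae (ae_of_all _ fun z => sq_nonneg _)
        hm.aestronglyMeasurable, ← h2, ENNReal.toReal_ofReal (by positivity)]
    have hineq := neg_le_of_abs_le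
      (abs_real_inner_le_norm (tensorSq q) (∑ j, (ψ (z j) - ∫ w, ψ w ∂ν)))
    rw [inner_sum, norm_tensorSq, norm_augmented_sq S hpos.le] at hineq
    have hsum : ∑ j, inner ℝ (tensorSq q) (ψ (z j) - ∫ w, ψ w ∂ν) =
        ∑ j, inner ℝ (k (z j)) h ^ 2 - n * ‖S h‖ ^ 2 := by
      simp [inner_sub_right, hψq, hmean]
    rw [hsum] at hineq
    have hq : 0 ≤ ‖S h‖ ^ 2 + lam₁ * ‖h‖ ^ 2 := by positivity
    have h3 := mul_le_mul_of_nonneg_left hlt.le hq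
    have h4 : n * ‖S h‖ ^ 2 ≤ n * (2 * (1 / n * ∑ j, inner ℝ (k (z j)) h ^ 2) +
        lam₁ * ‖h‖ ^ 2) := by
      have : n * (2 * (1 / n * ∑ j, inner ℝ (k (z j)) h ^ 2) + lam₁ * ‖h‖ ^ 2) =
          2 * (∑ j, inner ℝ (k (z j)) h ^ 2) + n * (lam₁ * ‖h‖ ^ 2) := by
        field_simp
      rw [this]
      linarith
    exact le_of_mul_le_mul_left h4 hn'
  · have : n * ((4 * l / n) ^ 2 * (κ ^ 2 / lam₁ * N)) - 4 * l / n * (n / 2) ≤ -l := by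
      have h5 : n * ((4 * l / n) ^ 2 * (κ ^ 2 / lam₁ * N)) =
          l * (16 * l * (κ ^ 2 / lam₁) * N) / n := by field_simp; ring
      have h6 : l * (16 * l * (κ ^ 2 / lam₁) * N) / n ≤ l := by
        rw [div_le_iff₀ hn']
        gcongr
        linarith
      have h7 : 4 * l / n * (n / 2) = 2 * l := by field_simp; ring
      rw [h5, h7]
      linarith
    gcongr

end LowerTail

/-! ### Gradient descent as a Landweber iteration -/

section Sampling

open ContinuousLinearMap

variable {H : Type*} [NormedAddCommGroup H] [InnerProductSpace ℝ H] {n : ℕ}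

/-- The normalized sampling operator `h ↦ (⟪k j, h⟫ / √n)ⱼ`. -/
noncomputable def sampOp (k : Fin n → H) : H →L[ℝ] EuclideanSpace ℝ (Fin n) :=
  (1 / √(n : ℝ)) • (((EuclideanSpace.equiv (Fin n) ℝ).symm :
    (Fin n → ℝ) →L[ℝ] EuclideanSpace ℝ (Fin n)) ∘L ContinuousLinearMap.pi fun j => innerSL ℝ (k j))

lemma sampOp_apply (k : Fin n → H) (h : H) (j : Fin n) :
    sampOp k h j = 1 / √(n : ℝ) * inner ℝ (k j) h := rfl

lemma norm_sampOp_apply_sq (k : Fin n → H) (h : H) :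
    ‖sampOp k h‖ ^ 2 = 1 / n * ∑ j, inner ℝ (k j) h ^ 2 := by
  rw [EuclideanSpace.norm_sq_eq, Finset.mul_sum]
  refine Finset.sum_congr rfl fun j _ => ?_
  rw [sampOp_apply, Real.norm_eq_abs, sq_abs, mul_pow, div_pow, Real.sq_sqrt (by positivity),
    one_pow]

lemma norm_sampOp_sq_le (k : Fin n → H) : ‖sampOp k‖ ^ 2 ≤ 1 / n * ∑ j, ‖k j‖ ^ 2 := by
  have h0 : 0 ≤ 1 / (n : ℝ) * ∑ j, ‖k j‖ ^ 2 := by positivity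
  rw [← Real.sq_sqrt h0]
  refine pow_le_pow_left₀ (norm_nonneg _) (opNorm_le_bound _ (by positivity) fun h => ?_) 2
  refine le_of_sq_le_sq ?_ (by positivity)
  rw [mul_pow, Real.sq_sqrt h0, norm_sampOp_apply_sq, mul_assoc, Finset.sum_mul]
  gcongr with j
  rw [← mul_pow, ← sq_abs]
  exact pow_le_pow_left₀ (abs_nonneg _) (abs_real_inner_le_norm _ _) 2

lemma one_div_mul_sum_le {a : Fin n → ℝ} {c : ℝ} (hc : 0 ≤ c) (ha : ∀ j, a j ≤ c) :
    1 / n * ∑ j, a j ≤ c := by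
  rcases Nat.eq_zero_or_pos n with rfl | hn
  · simpa using hc
  · have hn' : (0 : ℝ) < n := by exact_mod_cast hn
    rw [one_div, inv_mul_le_iff₀ hn']
    simpa using Finset.sum_le_sum fun j (_ : j ∈ Finset.univ) => ha j

lemma mul_norm_sampOp_sq_le_one {k : Fin n → H} {κ η : ℝ} (hη : 0 ≤ η) (hηκ : η * κ ^ 2 ≤ 1)
    (hk : ∀ j, ‖k j‖ ≤ κ) : η * ‖sampOp k‖ ^ 2 ≤ 1 := by
  refine (mul_le_mul_of_nonneg_left ((norm_sampOp_sq_le k).trans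
    (one_div_mul_sum_le (sq_nonneg κ) fun j => ?_)) hη).trans hηκ
  exact pow_le_pow_left₀ (norm_nonneg _) (hk j) 2

lemma sampOp_sub (k k' : Fin n → H) : sampOp k - sampOp k' = sampOp (k - k') := by
  ext h j
  change sampOp k h j - sampOp k' h j = _
  rw [sampOp_apply, sampOp_apply, sampOp_apply, Pi.sub_apply, inner_sub_left]
  ring

lemma adjoint_sampOp_apply [CompleteSpace H] (k : Fin n → H) (e : EuclideanSpace ℝ (Fin n)) :
    (sampOp k).adjoint e = (1 / √(n : ℝ)) • ∑ j, e j • k j := by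
  refine ext_inner_right ℝ fun h => ?_
  rw [adjoint_inner_left, PiLp.inner_apply, real_inner_smul_left, sum_inner, Finset.mul_sum]
  refine Finset.sum_congr rfl fun j _ => ?_
  rw [sampOp_apply, real_inner_smul_left]
  simp only [RCLike.inner_apply, conj_trivial]
  ring

/-- The normalized vector of labels. -/
noncomputable def labelVec (y : Fin n → ℝ) : EuclideanSpace ℝ (Fin n) :=
  WithLp.toLp 2 fun j => 1 / √(n : ℝ) * y j

lemma norm_labelVec_le {y : Fin n → ℝ} {M : ℝ} (hM : 0 ≤ M) (hy : ∀ j, |y j| ≤ M) :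
    ‖labelVec y‖ ≤ M := by
  refine le_of_sq_le_sq ?_ hM
  have h : ‖labelVec y‖ ^ 2 = 1 / n * ∑ j, y j ^ 2 := by
    rw [EuclideanSpace.norm_sq_eq, Finset.mul_sum]
    refine Finset.sum_congr rfl fun j _ => ?_
    rw [labelVec, Real.norm_eq_abs, sq_abs, mul_pow, div_pow, Real.sq_sqrt (by positivity),
      one_pow]
  rw [h]
  exact one_div_mul_sum_le (sq_nonneg M) fun j => sq_le_sq' (abs_le.1 (hy j)).1 (abs_le.1 (hy j)).2

variable [CompleteSpace H] {X : Type*} [RKHS ℝ H X ℝ]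

lemma gd_eq_landweber (p : Fin n → X) (y : Fin n → ℝ) (η : ℝ) (t : ℕ) :
    gd H p y η t = landweber (sampOp fun j => kerSec H (p j)) (labelVec y) η t := by
  induction t with
  | zero => rfl
  | succ t ih =>
    rw [gd, landweber, ← ih, adjoint_sampOp_apply, smul_smul, Finset.smul_sum, Finset.smul_sum]
    congr 1
    refine Finset.sum_congr rfl fun j _ => ?_
    change _ = (η * (1 / √(n : ℝ))) • (1 / √(n : ℝ) * inner ℝ (kerSec H (p j)) (gd H p y η t) -
      1 / √(n : ℝ) * y j) • kerSec H (p j)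
    rw [inner_kerSec, smul_smul, smul_smul, ← mul_sub]
    congr 1
    have h : 1 / (n : ℝ) = 1 / √(n : ℝ) * (1 / √(n : ℝ)) := by
      rw [← sq, div_pow, Real.sq_sqrt (by positivity), one_pow]
    rw [h]
    ring

/-- A tail average of differences is controlled by the differences, with a factor `2` in place of
the exact `2 (T - ⌊T / 2⌋) / T`. -/
lemma norm_map_tailGD_sub_le {G : Type*} [NormedAddCommGroup G] [NormedSpace ℝ G] (C : H →L[ℝ] G)
    (p p' : Fin n → X) (y : Fin n → ℝ) (η : ℝ) {T : ℕ} {c : ℝ} (hc : 0 ≤ c)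
    (h : ∀ t ≤ T, ‖C (gd H p' y η t - gd H p y η t)‖ ≤ c) :
    ‖C (tailGD H p' y η T - tailGD H p y η T)‖ ≤ 2 * c := by
  rw [tailGD, tailGD, ← smul_sub, ← Finset.sum_sub_distrib, map_smul, map_sum, norm_smul,
    Real.norm_of_nonneg (by positivity)]
  have h1 : ‖∑ t ∈ Finset.Icc (T / 2 + 1) T, C (gd H p' y η t - gd H p y η t)‖ ≤ T * c := by
    refine (norm_sum_le _ _).trans ((Finset.sum_le_sum fun t ht =>
      h t (Finset.mem_Icc.1 ht).2).trans ?_)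
    rw [Finset.sum_const, Nat.card_Icc, nsmul_eq_mul]
    gcongr
    omega
  rcases Nat.eq_zero_or_pos T with rfl | hT
  · simpa using hc
  · have hT' : (0 : ℝ) < T := by exact_mod_cast hT
    calc _ ≤ 2 / T * (T * c) := by gcongr
      _ = 2 * c := by field_simp

/-- Comparison of the two tail averages in the seminorm `‖S ·‖`, given that the covariance of `S` is
controlled by the first sample. Passing to the second sample costs one more factor
`‖sampOp k' - sampOp k‖`. -/
lemma norm_map_tailGD_sub_le_of_covariance {G : Type*} [NormedAddCommGroup G] [NormedSpace ℝ G]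
    (S : H →L[ℝ] G) {κ η M lam₁ : ℝ} (p p' : Fin n → X) (y : Fin n → ℝ)
    (hη : 0 < η) (hηκ : η * κ ^ 2 ≤ 1) (hk : ∀ x : X, ‖kerSec H x‖ ≤ κ)
    (hM : 0 ≤ M) (hy : ∀ j, |y j| ≤ M) {T : ℕ} (hT : 3 ≤ T) (hlam₁ : 0 ≤ lam₁)
    (hS : ∀ h : H, ‖S h‖ ^ 2 ≤
      2 * (1 / n * ∑ j, inner ℝ (kerSec H (p j)) h ^ 2) + lam₁ * ‖h‖ ^ 2) {Δ : ℝ}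
    (hΔ : ‖sampOp (fun j => kerSec H (p' j)) - sampOp fun j => kerSec H (p j)‖ ≤ Δ) :
    ‖S (tailGD H p' y η T - tailGD H p y η T)‖ ≤
      (24 * Real.log T * √(η * T) * M + 6 * √lam₁ * (η * T) * M) * Δ +
        12 * (η * T) * M * Δ ^ 2 := by
  set A := sampOp fun j => kerSec H (p j) with hAdef
  set A' := sampOp fun j => kerSec H (p' j)
  have hΔ0 : 0 ≤ Δ := (norm_nonneg _).trans hΔ
  have hlog : 0 ≤ Real.log T := zero_le_one.trans (one_le_log_of_three_le hT)
  have hA : η * ‖A‖ ^ 2 ≤ 1 := mul_norm_sampOp_sq_le_one hη.le hηκ fun j => hk _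
  have hA' : η * ‖A'‖ ^ 2 ≤ 1 := mul_norm_sampOp_sq_le_one hη.le hηκ fun j => hk _
  have hb := norm_labelVec_le hM hy
  set g := tailGD H p' y η T - tailGD H p y η T
  have h1 : ‖A' g‖ ≤ 2 * (6 * Real.log T * √(η * T) * Δ * M) := by
    refine norm_map_tailGD_sub_le A' p p' y η (by positivity) fun t ht => ?_
    rw [gd_eq_landweber, gd_eq_landweber]
    refine (norm_map_landweber_sub_le (labelVec y) hη hA hA' hT ht).trans ?_
    gcongr
  have h2 : ‖g‖ ≤ 2 * (3 * (η * T) * Δ * M) := by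
    refine norm_map_tailGD_sub_le (ContinuousLinearMap.id ℝ H) p p' y η (by positivity)
      fun t ht => ?_
    rw [gd_eq_landweber, gd_eq_landweber]
    refine (norm_landweber_sub_le (labelVec y) hη hA hA' ht).trans ?_
    gcongr
  have h3 : ‖A g‖ ≤ ‖A' g‖ + Δ * ‖g‖ := by
    have : A g = A' g - (A' - A) g := by simp
    rw [this]
    exact (norm_sub_le _ _).trans (by gcongr; exact le_of_opNorm_le _ hΔ _)
  have h4 : ‖S g‖ ≤ 2 * ‖A g‖ + √lam₁ * ‖g‖ := by
    refine le_of_sq_le_sq ((hS g).trans ?_) (by positivity)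
    rw [← norm_sampOp_apply_sq (fun j => kerSec H (p j)), ← hAdef, add_sq, mul_pow, mul_pow,
      Real.sq_sqrt hlam₁]
    have : 0 ≤ 2 * (2 * ‖A g‖) * (√lam₁ * ‖g‖) := by positivity
    nlinarith [sq_nonneg ‖A g‖]
  calc _ ≤ _ := h4
    _ ≤ 2 * (2 * (6 * Real.log T * √(η * T) * Δ * M) + Δ * (2 * (3 * (η * T) * Δ * M))) +
        √lam₁ * (2 * (3 * (η * T) * Δ * M)) := by
        have : ‖A g‖ ≤ 2 * (6 * Real.log T * √(η * T) * Δ * M) +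
            Δ * (2 * (3 * (η * T) * Δ * M)) := h3.trans (by gcongr)
        gcongr
    _ = _ := by ring

lemma stronglyMeasurable_gd {Ω : Type*} [MeasurableSpace Ω] {p : Ω → Fin n → X}
    (hp : ∀ j, StronglyMeasurable fun ω => kerSec H (p ω j)) (y : Fin n → ℝ) (η : ℝ) (t : ℕ) :
    StronglyMeasurable fun ω => gd H (p ω) y η t := by
  induction t with
  | zero => exact stronglyMeasurable_const
  | succ t ih =>
    simp only [gd, ← inner_kerSec]
    refine ih.sub (StronglyMeasurable.const_smul ?_ _)
    exact Finset.stronglyMeasurable_fun_sum _ fun j _ =>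
      (((hp j).inner ih).sub stronglyMeasurable_const).smul (hp j)

lemma stronglyMeasurable_tailGD {Ω : Type*} [MeasurableSpace Ω] {p : Ω → Fin n → X}
    (hp : ∀ j, StronglyMeasurable fun ω => kerSec H (p ω j)) (y : Fin n → ℝ) (η : ℝ) (T : ℕ) :
    StronglyMeasurable fun ω => tailGD H (p ω) y η T :=
  (Finset.stronglyMeasurable_fun_sum _ fun t _ => stronglyMeasurable_gd hp y η t).const_smul _

end Sampling

/-! ### Separability and measurability of the mean embedding -/

section Measurability

open TopologicalSpace

lemma separableSpace_of_isSeparable_range_kerSec {H X : Type*} [NormedAddCommGroup H]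
    [InnerProductSpace ℝ H] [CompleteSpace H] [RKHS ℝ H X ℝ]
    (h : IsSeparable (Set.range (kerSec H : X → H))) : SeparableSpace H := by
  have hspan : Submodule.span ℝ {RKHS.kerFun H x v | (x : X) (v : ℝ)} ≤
      Submodule.span ℝ (Set.range (kerSec H : X → H)) := by
    refine Submodule.span_le.2 ?_
    rintro _ ⟨x, v, rfl⟩
    have : RKHS.kerFun H x v = v • kerSec H x := by
      rw [kerSec, ← map_smul, smul_eq_mul, mul_one]
    rw [this]
    exact Submodule.smul_mem _ _ (Submodule.subset_span ⟨x, rfl⟩)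
  have hsep := (h.span (R := ℝ)).closure
  rw [← isSeparable_univ_iff]
  refine hsep.mono fun f _ => ?_
  have hf : f ∈ Submodule.topologicalClosure
      (Submodule.span ℝ {RKHS.kerFun H x v | (x : X) (v : ℝ)}) := by
    rw [RKHS.kerFun_dense]; trivial
  exact closure_mono hspan hf

variable {X : Type*} [TopologicalSpace X]
  {HG : Type*} [NormedAddCommGroup HG] [InnerProductSpace ℝ HG] [CompleteSpace HG]
  [RKHS ℝ HG X ℝ]

lemma continuous_kerSec (hG : Continuous fun p : X × X => ker HG p.1 p.2) :
    Continuous (kerSec HG : X → HG) := by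
  rw [continuous_iff_continuousAt]
  intro s
  rw [ContinuousAt, tendsto_iff_norm_sub_tendsto_zero]
  have h1 : Continuous fun t : X => √(ker HG t t - 2 * ker HG t s + ker HG s s) := by
    have h2 := hG.comp (f := fun t : X => (t, t)) (by fun_prop)
    have h3 := hG.comp (f := fun t : X => (t, s)) (by fun_prop)
    exact ((h2.sub (h3.const_mul 2)).add_const _).sqrt
  have h4 := h1.tendsto s
  have h5 : ker HG s s - 2 * ker HG s s + ker HG s s = 0 := by ring
  rw [h5, Real.sqrt_zero] at h4
  refine h4.congr fun t => ?_
  have h6 : ker HG t t - 2 * ker HG t s + ker HG s s = ‖kerSec HG t - kerSec HG s‖ ^ 2 := by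
    rw [norm_sub_sq_real, ← real_inner_self_eq_norm_sq, ← real_inner_self_eq_norm_sq,
      inner_kerSec_kerSec, inner_kerSec_kerSec, inner_kerSec_kerSec]
  rw [h6, Real.sqrt_sq (norm_nonneg _)]

lemma secondCountableTopology_embSpace [CompactSpace X]
    [MeasurableSpace X] (hG : Continuous fun p : X × X => ker HG p.1 p.2) :
    SecondCountableTopology (EmbSpace HG : Type _) := by
  have : SeparableSpace HG := separableSpace_of_isSeparable_range_kerSec (X := X)
    (isCompact_range (continuous_kerSec hG)).isSeparable
  have : SecondCountableTopology HG := UniformSpace.secondCountable_of_separable HG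
  infer_instance

variable [MeasurableSpace X] [BorelSpace X] [CompactSpace X] [MeasurableSpace HG] [BorelSpace HG]

lemma stronglyMeasurable_kerSec (hG : Continuous fun p : X × X => ker HG p.1 p.2) :
    StronglyMeasurable (kerSec HG : X → HG) :=
  stronglyMeasurable_iff_measurable_separable.2
    ⟨(continuous_kerSec hG).measurable, (isCompact_range (continuous_kerSec hG)).isSeparable⟩

lemma stronglyMeasurable_meanEmb (hG : Continuous fun p : X × X => ker HG p.1 p.2) :
    StronglyMeasurable (meanEmb HG : ProbabilityMeasure X → HG) := by
  let K : Kernel (ProbabilityMeasure X) X := ⟨fun x => (x : Measure X), measurable_subtype_coe⟩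
  have : IsMarkovKernel K := ⟨fun x => inferInstanceAs (IsProbabilityMeasure (x : Measure X))⟩
  exact (stronglyMeasurable_kerSec hG).integral_kernel (κ := K)

lemma measurable_emb (hG : Continuous fun p : X × X => ker HG p.1 p.2) :
    Measurable (emb HG : ProbabilityMeasure X → EmbSpace HG) :=
  (stronglyMeasurable_meanEmb hG).measurable.subtype_mk

end Measurability

/-! ### The second-stage sample -/

section SecondStage

open TopologicalSpace

lemma rpow_sq_le {α u : ℝ} (hα : 0 < α) (hα1 : α ≤ 1) (hu : 0 ≤ u) {N : ℕ} (hN : 0 < N) :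
    (u ^ α) ^ 2 ≤ (1 / (N : ℝ) ^ (α / 2)) ^ 2 * (1 + N * u ^ 2) := by
  have hN' : (0 : ℝ) < N := by exact_mod_cast hN
  have h1 : (N * u ^ 2) ^ α ≤ 1 + N * u ^ 2 := by
    have hw : 0 ≤ N * u ^ 2 := by positivity
    rcases le_total (N * u ^ 2) 1 with h | h
    · exact (Real.rpow_le_one hw h hα.le).trans (by linarith)
    · exact (Real.rpow_le_rpow_of_exponent_le h hα1).trans (by rw [Real.rpow_one]; linarith)
  have h2 : ((N : ℝ) ^ (α / 2)) ^ 2 = (N : ℝ) ^ α := by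
    rw [← Real.rpow_natCast, ← Real.rpow_mul hN'.le]; norm_num
  have h3 : (N * u ^ 2) ^ α = (N : ℝ) ^ α * (u ^ α) ^ 2 := by
    rw [Real.mul_rpow hN'.le (by positivity), ← Real.rpow_natCast, ← Real.rpow_natCast,
      ← Real.rpow_mul hu, ← Real.rpow_mul hu, mul_comm]
    ring_nf
  rw [h3] at h1
  rw [div_pow, one_pow, h2, div_mul_eq_mul_div, one_mul, le_div_iff₀ (by positivity)]
  linarith

section KernelSections

variable {X : Type*} [MeasurableSpace X] {HG : Type*} [NormedAddCommGroup HG]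
  [InnerProductSpace ℝ HG] [CompleteSpace HG] [RKHS ℝ HG X ℝ]

/-- The mean square distance between the kernel sections of the two samples. -/
noncomputable def sampleDist (HK : Type*) [NormedAddCommGroup HK] [InnerProductSpace ℝ HK]
    [CompleteSpace HK] [RKHS ℝ HK (EmbSpace HG) ℝ] {n N : ℕ} [NeZero N]
    (z : Fin n → ProbabilityMeasure X × ℝ) (s : Fin n → Fin N → X) : ℝ :=
  1 / n * ∑ j, ‖kerSec HK (emb HG (empirical (s j))) - kerSec HK (emb HG (z j).1)‖ ^ 2

lemma sampleDist_nonneg {HK : Type*} [NormedAddCommGroup HK] [InnerProductSpace ℝ HK]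
    [CompleteSpace HK] [RKHS ℝ HK (EmbSpace HG) ℝ] {n N : ℕ} [NeZero N] (z : Fin n → ProbabilityMeasure X × ℝ)
    (s : Fin n → Fin N → X) : 0 ≤ sampleDist (HG := HG) HK z s := by
  unfold sampleDist; positivity

variable [TopologicalSpace X] {HK : Type*} [NormedAddCommGroup HK] [InnerProductSpace ℝ HK]
  [CompleteSpace HK] [RKHS ℝ HK (EmbSpace HG) ℝ] {κ γ L α : ℝ}

lemma KernelAssumptions.continuous_kerSec (hα : 0 < α) (h : KernelAssumptions HG HK κ γ L α) :
    Continuous (kerSec HK : EmbSpace HG → HK) := by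
  rw [continuous_iff_continuousAt]
  intro ξ₀
  rw [ContinuousAt, tendsto_iff_norm_sub_tendsto_zero]
  have h1 : Continuous fun ξ : EmbSpace HG => L * ‖(ξ : HG) - (ξ₀ : HG)‖ ^ α :=
    ((Real.continuous_rpow_const hα.le).comp (by fun_prop)).const_mul L
  have h0 := h1.tendsto ξ₀
  rw [sub_self, norm_zero, Real.zero_rpow hα.ne', mul_zero] at h0
  exact squeeze_zero (fun _ => norm_nonneg _) (fun ξ => h.holder_K ξ ξ₀) h0

lemma KernelAssumptions.stronglyMeasurable_kerSec [CompactSpace X]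
    [MeasurableSpace HG] [BorelSpace HG] (hα : 0 < α)
    (h : KernelAssumptions HG HK κ γ L α) : StronglyMeasurable (kerSec HK : EmbSpace HG → HK) := by
  have := secondCountableTopology_embSpace h.continuous_G
  exact (h.continuous_kerSec hα).stronglyMeasurable

lemma KernelAssumptions.separableSpace [CompactSpace X] (hα : 0 < α)
    (h : KernelAssumptions HG HK κ γ L α) : SeparableSpace HK := by
  have := secondCountableTopology_embSpace h.continuous_G
  exact separableSpace_of_isSeparable_range_kerSec (isSeparable_range (h.continuous_kerSec hα))

lemma SK_ae_eq [MeasurableSpace HG] [BorelSpace HG] (hκ : 0 ≤ κ) (hα : 0 < α) (h : KernelAssumptions HG HK κ γ L α)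
    (P : Measure (ProbabilityMeasure X × ℝ)) [IsFiniteMeasure P] (f : HK) :
    SK hκ hα h P f =ᵐ[lawMu HG P] fun ξ => inner ℝ (kerSec HK ξ) f := by
  simp_rw [inner_kerSec]
  exact MemLp.coeFn_toLp (f := fun ξ => f ξ)
    (MemLp.of_bound (h.measurable hα f).aestronglyMeasurable (κ * ‖f‖) (ae_of_all _ fun ξ => by
      simpa [Real.norm_eq_abs] using abs_apply_le hκ (h.bound_K ξ) f))

end KernelSections

variable {X : Type*} [TopologicalSpace X] [CompactSpace X] [MeasurableSpace X] [BorelSpace X]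
  {HG : Type*} [NormedAddCommGroup HG] [InnerProductSpace ℝ HG] [CompleteSpace HG]
  [MeasurableSpace HG] [BorelSpace HG] [RKHS ℝ HG X ℝ]

lemma meanEmb_empirical (hG : Continuous fun p : X × X => ker HG p.1 p.2) {N : ℕ} [NeZero N]
    (s : Fin N → X) :
    meanEmb HG (empirical s) = (1 / (N : ℝ)) • ∑ i, kerSec HG (s i) := by
  have hk := stronglyMeasurable_kerSec hG
  change ∫ u, kerSec HG u ∂((N : ENNReal)⁻¹ • ∑ i, Measure.dirac (s i)) = _
  rw [integral_smul_measure, integral_finsetSum_measure fun i _ => ?_]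
  · simp_rw [integral_dirac' _ _ hk]
    simp
  · exact integrable_dirac' hk (by simp)

lemma measurable_emb_empirical (hG : Continuous fun p : X × X => ker HG p.1 p.2) {N : ℕ}
    [NeZero N] : Measurable fun s : Fin N → X => emb HG (empirical s) := by
  refine Measurable.subtype_mk ?_
  simp_rw [meanEmb_empirical hG]
  exact ((Finset.stronglyMeasurable_fun_sum _ fun i _ =>
    (stronglyMeasurable_kerSec hG).comp_measurable (measurable_pi_apply i)).const_smul
      (1 / (N : ℝ))).measurable

/-- The mean square error of the empirical mean embedding of a bag of `N` points is at most
`γ² / N`. -/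
lemma lintegral_norm_meanEmb_empirical_sub_sq_le
    (hG : Continuous fun p : X × X => ker HG p.1 p.2) {γ : ℝ} (hγ : 0 ≤ γ)
    (hb : ∀ s : X, ker HG s s ≤ γ ^ 2) {N : ℕ} [NeZero N] (x : ProbabilityMeasure X) :
    ∫⁻ s, ENNReal.ofReal (N * ‖meanEmb HG (empirical s) - meanEmb HG x‖ ^ 2)
      ∂(Measure.pi fun _ : Fin N => (x : Measure X)) ≤ ENNReal.ofReal (γ ^ 2) := by
  have hk := stronglyMeasurable_kerSec hG
  have hN : (0 : ℝ) < N := by exact_mod_cast Nat.pos_of_ne_zero (NeZero.ne N)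
  have hkb : ∀ s : X, ‖kerSec HG s‖ ≤ γ := fun s => norm_kerSec_le hγ (hb s)
  have hint : Integrable (kerSec HG) (x : Measure X) :=
    .of_bound hk.aestronglyMeasurable γ (ae_of_all _ hkb)
  have hint2 : Integrable (fun s => ‖kerSec HG s‖ ^ 2) (x : Measure X) :=
    .of_bound (hk.norm.pow 2).aestronglyMeasurable (γ ^ 2) (ae_of_all _ fun s => by
      rw [Real.norm_of_nonneg (by positivity)]
      exact pow_le_pow_left₀ (norm_nonneg _) (hkb s) 2)
  set m := meanEmb HG x with hm
  have hm' : ∫ s, kerSec HG s ∂(x : Measure X) = m := rfl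
  have hmγ : ‖m‖ ≤ γ := by
    refine (norm_integral_le_integral_norm _).trans ?_
    refine (integral_mono hint.norm (integrable_const γ) hkb).trans_eq ?_
    simp
  have hvar : ∫ s, ‖kerSec HG s - m‖ ^ 2 ∂(x : Measure X) ≤ γ ^ 2 := by
    have h1 : Integrable (fun s => ‖kerSec HG s‖ ^ 2 - 2 * inner ℝ m (kerSec HG s))
        (x : Measure X) := hint2.sub ((hint.const_inner m).const_mul 2)
    simp_rw [norm_sub_sq_real, real_inner_comm m]
    rw [integral_add h1 (integrable_const _), integral_sub hint2
      ((hint.const_inner m).const_mul 2), integral_const_mul, integral_inner hint, hm']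
    have h2 : ∫ s, ‖kerSec HG s‖ ^ 2 ∂(x : Measure X) ≤ γ ^ 2 := by
      refine (integral_mono hint2 (integrable_const (γ ^ 2)) fun s =>
        pow_le_pow_left₀ (norm_nonneg _) (hkb s) 2).trans_eq ?_
      simp
    simp only [integral_const, probReal_univ, smul_eq_mul, one_mul]
    rw [real_inner_self_eq_norm_sq]
    linarith [sq_nonneg ‖m‖]
  have hY : StronglyMeasurable fun s => kerSec HG s - m := hk.sub stronglyMeasurable_const
  have hsum := lintegral_norm_sum_sq_le (P := (x : Measure X)) (c := γ + γ) hY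
    (fun s => (norm_sub_le _ _).trans (add_le_add (hkb s) hmγ)) (by
      rw [integral_sub hint (integrable_const _), hm']; simp) N
  have heq : ∀ s : Fin N → X, N * ‖meanEmb HG (empirical s) - m‖ ^ 2 =
      1 / N * ‖∑ i, (kerSec HG (s i) - m)‖ ^ 2 := by
    intro s
    have h1 : meanEmb HG (empirical s) - m = (1 / (N : ℝ)) • ∑ i, (kerSec HG (s i) - m) := by
      rw [meanEmb_empirical hG]
      simp only [Finset.sum_sub_distrib, Finset.sum_const, Finset.card_univ,
        Fintype.card_fin, smul_sub]
      rw [← Nat.cast_smul_eq_nsmul ℝ, smul_smul, one_div, inv_mul_cancel₀ hN.ne', one_smul]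
    rw [h1, norm_smul, mul_pow, Real.norm_of_nonneg (by positivity)]
    field_simp
  simp_rw [heq, ENNReal.ofReal_mul (show (0 : ℝ) ≤ 1 / N by positivity)]
  rw [lintegral_const_mul' _ _ ENNReal.ofReal_ne_top]
  calc _ ≤ ENNReal.ofReal (1 / N) * (N * ENNReal.ofReal (γ ^ 2)) := by
        gcongr
        refine hsum.trans ?_
        gcongr
    _ = ENNReal.ofReal (γ ^ 2) := by
        rw [← ENNReal.ofReal_natCast, ← ENNReal.ofReal_mul (by positivity),
          ← ENNReal.ofReal_mul (by positivity)]
        congr 1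
        field_simp

variable {HK : Type*} [NormedAddCommGroup HK] [InnerProductSpace ℝ HK] [CompleteSpace HK]
  [RKHS ℝ HK (EmbSpace HG) ℝ] {κ γ L α : ℝ}

/-- The Hölder condition transfers the rate `1 / N` of the mean embeddings to the kernel sections.
The exponent `α ≤ 1` is handled by `w ^ α ≤ 1 + w` for `w = N ‖·‖²`. -/
lemma lintegral_norm_kerSec_sub_sq_le (hγ : 0 ≤ γ) (hα : 0 < α) (hα1 : α ≤ 1)
    (h : KernelAssumptions HG HK κ γ L α) {N : ℕ} [NeZero N] (x : ProbabilityMeasure X) :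
    ∫⁻ s, ENNReal.ofReal (‖kerSec HK (emb HG (empirical s)) - kerSec HK (emb HG x)‖ ^ 2)
      ∂(Measure.pi fun _ : Fin N => (x : Measure X)) ≤
      ENNReal.ofReal ((L / (N : ℝ) ^ (α / 2)) ^ 2 * (1 + γ ^ 2)) := by
  have hN : 0 < N := Nat.pos_of_ne_zero (NeZero.ne N)
  have hpt : ∀ s : Fin N → X,
      ‖kerSec HK (emb HG (empirical s)) - kerSec HK (emb HG x)‖ ^ 2 ≤
        (L / (N : ℝ) ^ (α / 2)) ^ 2 *
          (1 + N * ‖meanEmb HG (empirical s) - meanEmb HG x‖ ^ 2) := by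
    intro s
    refine (pow_le_pow_left₀ (norm_nonneg _) (h.holder_K _ _) 2).trans ?_
    rw [mul_pow]
    refine (mul_le_mul_of_nonneg_left (rpow_sq_le hα hα1 (norm_nonneg _) hN)
      (sq_nonneg L)).trans_eq ?_
    simp only [emb]
    ring
  calc _ ≤ ∫⁻ s, ENNReal.ofReal ((L / (N : ℝ) ^ (α / 2)) ^ 2) *
        (1 + ENNReal.ofReal (N * ‖meanEmb HG (empirical s) - meanEmb HG x‖ ^ 2))
        ∂(Measure.pi fun _ : Fin N => (x : Measure X)) := by
        refine lintegral_mono fun s => (ENNReal.ofReal_le_ofReal (hpt s)).trans_eq ?_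
        rw [ENNReal.ofReal_mul (sq_nonneg _), ENNReal.ofReal_add zero_le_one (by positivity),
          ENNReal.ofReal_one]
    _ ≤ ENNReal.ofReal ((L / (N : ℝ) ^ (α / 2)) ^ 2) * (1 + ENNReal.ofReal (γ ^ 2)) := by
        rw [lintegral_const_mul' _ _ ENNReal.ofReal_ne_top,
          lintegral_add_left measurable_const]
        gcongr
        · simp
        · exact lintegral_norm_meanEmb_empirical_sub_sq_le h.continuous_G hγ h.bound_G x
    _ = _ := by
        rw [ENNReal.ofReal_mul (sq_nonneg _), ENNReal.ofReal_add zero_le_one (sq_nonneg _),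
          ENNReal.ofReal_one]

lemma stronglyMeasurable_kerSec_emb_empirical (hα : 0 < α) (h : KernelAssumptions HG HK κ γ L α)
    {n N : ℕ} [NeZero N] (j : Fin n) :
    StronglyMeasurable fun s : Fin n → Fin N → X => kerSec HK (emb HG (empirical (s j))) :=
  (h.stronglyMeasurable_kerSec hα).comp_measurable
    ((measurable_emb_empirical h.continuous_G).comp (measurable_pi_apply j))

instance {n N : ℕ} (z : Fin n → ProbabilityMeasure X × ℝ) :
    IsProbabilityMeasure (secondStage N z) := by
  unfold secondStage; infer_instance

lemma integrable_sampleDist (hκ : 0 ≤ κ) (hα : 0 < α) (h : KernelAssumptions HG HK κ γ L α)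
    {n N : ℕ} [NeZero N] (z : Fin n → ProbabilityMeasure X × ℝ) :
    Integrable (sampleDist (HG := HG) HK (N := N) z) (secondStage N z) := by
  have hm : StronglyMeasurable (sampleDist (HG := HG) HK (N := N) z) :=
    (Finset.stronglyMeasurable_fun_sum _ fun j _ =>
      ((stronglyMeasurable_kerSec_emb_empirical hα h j).sub
        stronglyMeasurable_const).norm.pow 2).const_mul _
  refine .of_bound hm.aestronglyMeasurable ((κ + κ) ^ 2) (ae_of_all _ fun s => ?_)
  rw [Real.norm_of_nonneg (sampleDist_nonneg z s)]
  refine one_div_mul_sum_le (sq_nonneg _) fun j => pow_le_pow_left₀ (norm_nonneg _) ?_ 2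
  exact (norm_sub_le _ _).trans
    (add_le_add (norm_kerSec_le hκ (h.bound_K _)) (norm_kerSec_le hκ (h.bound_K _)))

lemma integral_sampleDist_le (hκ : 0 ≤ κ) (hγ : 0 ≤ γ) (hα : 0 < α) (hα1 : α ≤ 1)
    (h : KernelAssumptions HG HK κ γ L α) {n N : ℕ} [NeZero N]
    (z : Fin n → ProbabilityMeasure X × ℝ) :
    ∫ s, sampleDist (HG := HG) HK (N := N) z s ∂(secondStage N z) ≤
      (L / (N : ℝ) ^ (α / 2)) ^ 2 * (1 + γ ^ 2) := by
  have hj : ∀ j : Fin n,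
      Integrable (fun s : Fin n → Fin N → X =>
        ‖kerSec HK (emb HG (empirical (s j))) - kerSec HK (emb HG (z j).1)‖ ^ 2)
        (secondStage N z) ∧
      ∫ s, ‖kerSec HK (emb HG (empirical (s j))) - kerSec HK (emb HG (z j).1)‖ ^ 2
        ∂(secondStage N z) ≤ (L / (N : ℝ) ^ (α / 2)) ^ 2 * (1 + γ ^ 2) := by
    intro j
    have hm : StronglyMeasurable fun s : Fin n → Fin N → X =>
        ‖kerSec HK (emb HG (empirical (s j))) - kerSec HK (emb HG (z j).1)‖ ^ 2 :=
      ((stronglyMeasurable_kerSec_emb_empirical hα h j).sub stronglyMeasurable_const).norm.pow 2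
    refine ⟨.of_bound hm.aestronglyMeasurable ((κ + κ) ^ 2) (ae_of_all _ fun s => ?_), ?_⟩
    · rw [Real.norm_of_nonneg (by positivity)]
      refine pow_le_pow_left₀ (norm_nonneg _) ?_ 2
      exact (norm_sub_le _ _).trans
        (add_le_add (norm_kerSec_le hκ (h.bound_K _)) (norm_kerSec_le hκ (h.bound_K _)))
    · have hm1 : StronglyMeasurable fun s : Fin N → X =>
          ‖kerSec HK (emb HG (empirical s)) - kerSec HK (emb HG (z j).1)‖ ^ 2 :=
        (((h.stronglyMeasurable_kerSec hα).comp_measurable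
          (measurable_emb_empirical h.continuous_G)).sub stronglyMeasurable_const).norm.pow 2
      rw [integral_eq_lintegral_of_nonneg_ae (ae_of_all _ fun s => sq_nonneg _)
        hm.aestronglyMeasurable]
      refine ENNReal.toReal_le_of_le_ofReal (by positivity) ?_
      have hmp := measurePreserving_eval
        (fun j : Fin n => Measure.pi fun _ : Fin N => ((z j).1 : Measure X)) j
      exact (hmp.lintegral_comp hm1.measurable.ennreal_ofReal).trans_le
        (lintegral_norm_kerSec_sub_sq_le hγ hα hα1 h (z j).1)
  unfold sampleDist
  rw [integral_const_mul, integral_finsetSum _ fun j _ => (hj j).1]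
  exact one_div_mul_sum_le (by positivity) fun j => (hj j).2

end SecondStage

/-! ### The bound on the second-stage variance -/

section Final

open TopologicalSpace

variable {X : Type*} [TopologicalSpace X] [CompactSpace X] [MeasurableSpace X] [BorelSpace X]
  {HG : Type*} [NormedAddCommGroup HG] [InnerProductSpace ℝ HG] [CompleteSpace HG]
  [MeasurableSpace HG] [BorelSpace HG] [RKHS ℝ HG X ℝ]
  {HK : Type*} [NormedAddCommGroup HK] [InnerProductSpace ℝ HK] [CompleteSpace HK]
  [RKHS ℝ HK (EmbSpace HG) ℝ] {κ γ L α : ℝ}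

lemma measurePreserving_emb (hG : Continuous fun p : X × X => ker HG p.1 p.2)
    (P : Measure (ProbabilityMeasure X × ℝ)) :
    MeasurePreserving (fun z : ProbabilityMeasure X × ℝ => emb HG z.1) P (lawMu HG P) := by
  have h1 : Measurable fun z : ProbabilityMeasure X × ℝ => emb HG z.1 :=
    (measurable_emb hG).comp measurable_fst
  refine ⟨h1, ?_⟩
  rw [lawMu, lawZ, Measure.fst, Measure.map_map measurable_fst (h1.prodMk measurable_snd)]
  rfl

/-- The first-stage covariance event, transported from `ρ_μ` to the law of the first-stage
sample. -/
lemma measure_first_stage_not_covariance_le (hκ : 0 ≤ κ) (hα : 0 < α)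
    (h : KernelAssumptions HG HK κ γ L α) (P : Measure (ProbabilityMeasure X × ℝ))
    [IsProbabilityMeasure P] {lam lam₁ l : ℝ} {n : ℕ} (hn : 0 < n) (hlam : 0 < lam)
    (hle : lam ≤ lam₁) (hl : 0 ≤ l)
    (hlam₁ : 8 * κ ^ 2 * (1 + 2 * effDim (intOp (SK hκ hα h P)) lam) * l / n ≤ lam₁) :
    (Measure.pi fun _ : Fin n => P)
      {z | ¬ ∀ f : HK, ‖SK hκ hα h P f‖ ^ 2 ≤
        2 * (1 / n * ∑ j, inner ℝ (kerSec HK (emb HG (z j).1)) f ^ 2) + lam₁ * ‖f‖ ^ 2} ≤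
      ENNReal.ofReal (2 * Real.exp (-l)) := by
  have hmp := measurePreserving_emb h.continuous_G P
  have : IsProbabilityMeasure (lawMu HG P) := by
    rw [← hmp.map_eq]
    exact Measure.isProbabilityMeasure_map hmp.measurable.aemeasurable
  have := h.separableSpace hα
  have := secondCountableTopology_embSpace h.continuous_G
  have : Fact ((2 : ENNReal) ≠ ⊤) := ⟨by simp⟩
  have hpi := measurePreserving_pi (fun _ : Fin n => P) (fun _ : Fin n => lawMu HG P)
    fun _ => hmp
  have htail := measure_not_covariance_le (h.stronglyMeasurable_kerSec hα) (SK_ae_eq hκ hα h P)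
    (fun ξ => norm_kerSec_le hκ (h.bound_K ξ)) hn hlam hle hl hlam₁
  rw [← hpi.map_eq] at htail
  exact (Measure.le_map_apply hpi.measurable.aemeasurable _).trans htail

/-- On the covariance event, the conditional expectation over the second stage is estimated through
that of `sampleDist`, whose square root is linearized around its root mean square bound `q`. -/
lemma integrable_gdGap_and_integral_le (hκ : 0 ≤ κ) (hγ : 0 ≤ γ) (hL : 0 < L) (hα : 0 < α)
    (hα1 : α ≤ 1) (h : KernelAssumptions HG HK κ γ L α) {ν : Measure (EmbSpace HG)}
    (S : HK →L[ℝ] Lp ℝ 2 ν) {n N T : ℕ} [NeZero N] {η M lam₁ : ℝ} (hη : 0 < η)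
    (hηκ : η * κ ^ 2 ≤ 1) (hT : 3 ≤ T) (hM : 0 ≤ M) (hlam₁ : 0 ≤ lam₁)
    {z : Fin n → ProbabilityMeasure X × ℝ} (hz : ∀ j, |(z j).2| ≤ M)
    (hS : ∀ f : HK, ‖S f‖ ^ 2 ≤
      2 * (1 / n * ∑ j, inner ℝ (kerSec HK (emb HG (z j).1)) f ^ 2) + lam₁ * ‖f‖ ^ 2) {q : ℝ}
    (hq : q = L * √(1 + γ ^ 2) / (N : ℝ) ^ (α / 2)) :
    Integrable (gdGap (N := N) S η T z) (secondStage N z) ∧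
      ∫ s, gdGap (N := N) S η T z s ∂(secondStage N z) ≤
        (24 * Real.log T * √(η * T) * M + 6 * √lam₁ * (η * T) * M) * q +
          12 * (η * T) * M * q ^ 2 := by
  have hN : (0 : ℝ) < N := by exact_mod_cast Nat.pos_of_ne_zero (NeZero.ne N)
  have hq0 : 0 < q := by rw [hq]; positivity
  have hlog : 0 ≤ Real.log T := zero_le_one.trans (one_le_log_of_three_le hT)
  set a := 24 * Real.log T * √(η * T) * M + 6 * √lam₁ * (η * T) * M with ha
  set b := 12 * (η * T) * M with hb
  have ha0 : 0 ≤ a := by positivity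
  have hb0 : 0 ≤ b := by positivity
  have hpt : ∀ s, gdGap (N := N) S η T z s ≤
      (a / (2 * q) + b) * sampleDist (HG := HG) HK z s + a * q / 2 := by
    intro s
    set D := sampleDist (HG := HG) HK z s with hD
    have hD0 : 0 ≤ D := sampleDist_nonneg z s
    have h1 := norm_map_tailGD_sub_le_of_covariance S (fun j => emb HG (z j).1)
      (fun j => emb HG (empirical (s j))) (fun j => (z j).2) hη hηκ
      (fun ξ => norm_kerSec_le hκ (h.bound_K ξ)) hM hz hT hlam₁ hS (Δ := √D) (by
        refine Real.le_sqrt_of_sq_le ?_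
        rw [sampOp_sub]
        exact norm_sampOp_sq_le _)
    rw [Real.sq_sqrt hD0] at h1
    have h2 : √D ≤ D / (2 * q) + q / 2 := by
      have h3 : 0 ≤ (√D - q) ^ 2 / (2 * q) := by positivity
      have h4 : (√D - q) ^ 2 / (2 * q) = D / (2 * q) + q / 2 - √D := by
        rw [sub_sq, Real.sq_sqrt hD0]
        field_simp
        ring
      linarith
    refine h1.trans ((add_le_add_left (mul_le_mul_of_nonneg_left h2 ha0) _).trans_eq ?_)
    ring
  have hint := integrable_sampleDist (N := N) hκ hα h z
  have hint' : Integrable (fun s => (a / (2 * q) + b) * sampleDist (HG := HG) HK z s + a * q / 2)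
      (secondStage N z) := (hint.const_mul _).add (integrable_const _)
  have hmeas : StronglyMeasurable (gdGap (N := N) S η T z) :=
    (S.continuous.comp_stronglyMeasurable ((stronglyMeasurable_tailGD
      (fun j => stronglyMeasurable_kerSec_emb_empirical hα h j) _ η T).sub
        stronglyMeasurable_const)).norm
  have hgap : Integrable (gdGap (N := N) S η T z) (secondStage N z) :=
    hint'.mono' hmeas.aestronglyMeasurable (ae_of_all _ fun s => by
      rw [Real.norm_of_nonneg (show 0 ≤ gdGap (N := N) S η T z s from norm_nonneg _)]; exact hpt s)
  refine ⟨hgap, (integral_mono hgap hint' hpt).trans ?_⟩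
  rw [integral_add (hint.const_mul _) (integrable_const _), integral_const_mul]
  have hDq : ∫ s, sampleDist (HG := HG) HK (N := N) z s ∂(secondStage N z) ≤ q ^ 2 := by
    refine (integral_sampleDist_le hκ hγ hα hα1 h z).trans_eq ?_
    rw [hq, div_pow, div_pow, mul_pow, Real.sq_sqrt (by positivity)]
    ring
  calc _ ≤ (a / (2 * q) + b) * q ^ 2 + a * q / 2 := by
        simp only [integral_const, probReal_univ, smul_eq_mul, one_mul]
        gcongr
    _ = _ := by
        field_simp
        ring

/-- The arithmetic that turns the bound on the conditional expectation into the form with `𝓑`;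
`Np` stands for `N ^ (α / 2)` and `E` for the effective dimension. -/
lemma gap_bound_le {κ M c τ l lg Np E n : ℝ} (hκ : 0 ≤ κ) (hM : 0 ≤ M) (hc : 0 ≤ c) (hτ : 0 < τ)
    (hl : 1 ≤ l) (hlg : 1 ≤ lg) (hNp : 1 ≤ Np) (hE : 0 ≤ E) (hn : 0 < n) :
    (24 * lg * √τ * M + 6 * √(1 / τ + 8 * κ ^ 2 * (1 + 2 * E) * l / n) * τ * M) * (c / Np) +
        12 * τ * M * (c / Np) ^ 2 ≤
      M * c * (30 + 24 * κ + 12 * c) * l * lg * (√τ / Np) *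
        (2 * τ / n + √(τ * E / n) + τ / Np + 1) := by
  set B := 2 * τ / n + √(τ * E / n) + τ / Np + 1 with hB
  have hNp0 : 0 < Np := by linarith
  have hB1 : 1 ≤ B := by
    have : 0 ≤ 2 * τ / n + √(τ * E / n) + τ / Np := by positivity
    linarith
  have hll : 1 ≤ l * lg := one_le_mul_of_one_le_of_one_le hl hlg
  -- `√lam₁ τ = √τ √(lam₁ τ)`, and `√(lam₁ τ)` is split over the three summands of `lam₁ τ`.
  have h1 : √(1 / τ + 8 * κ ^ 2 * (1 + 2 * E) * l / n) * τ ≤ √τ * ((1 + 4 * κ) * l * B) := by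
    have hsplit : √(1 / τ + 8 * κ ^ 2 * (1 + 2 * E) * l / n) * τ =
        √τ * √(1 + 8 * κ ^ 2 * (1 + 2 * E) * l * τ / n) := by
      have : 1 + 8 * κ ^ 2 * (1 + 2 * E) * l * τ / n =
          (1 / τ + 8 * κ ^ 2 * (1 + 2 * E) * l / n) * τ := by field_simp
      rw [this, Real.sqrt_mul (by positivity)]
      linear_combination -√(1 / τ + 8 * κ ^ 2 * (1 + 2 * E) * l / n) * Real.mul_self_sqrt hτ.le
    rw [hsplit]
    gcongr
    refine Real.sqrt_le_iff.2 ⟨by positivity, ?_⟩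
    set t := τ / n with ht
    set u := √(τ * E / n) with hu
    have ht0 : 0 ≤ t := by positivity
    have hu0 : 0 ≤ u := Real.sqrt_nonneg _
    have husq : u ^ 2 = t * E := by rw [hu, Real.sq_sqrt (by positivity)]; ring
    have hBge : 1 + 2 * t + u ≤ B := by
      have : 0 ≤ τ / Np := by positivity
      have : 2 * τ / n = 2 * t := by rw [ht]; ring
      rw [hB]; linarith
    have e1 : 8 * κ ^ 2 * (1 + 2 * E) * l * τ / n = l * (κ ^ 2 * (8 * t + 16 * u ^ 2)) := by
      rw [husq, ht]; ring
    have e2 : 8 * t + 16 * u ^ 2 ≤ 16 * (1 + 2 * t + u) ^ 2 := by nlinarith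
    have e3 : (1 + 2 * t + u) ^ 2 ≤ B ^ 2 := pow_le_pow_left₀ (by positivity) hBge 2
    have e4 : l ≤ l ^ 2 := by nlinarith
    calc 1 + 8 * κ ^ 2 * (1 + 2 * E) * l * τ / n
        = 1 + l * (κ ^ 2 * (8 * t + 16 * u ^ 2)) := by rw [e1]
      _ ≤ l ^ 2 * B ^ 2 + l ^ 2 * (κ ^ 2 * (16 * B ^ 2)) := by
          gcongr ?_ + ?_
          · rw [← mul_pow]; exact one_le_pow₀ (one_le_mul_of_one_le_of_one_le hl hB1)
          · gcongr
            linarith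
      _ ≤ ((1 + 4 * κ) * l * B) ^ 2 := by
          have : 0 ≤ κ * (l ^ 2 * B ^ 2) := by positivity
          nlinarith
  have h2 : √τ * (1 / Np) ≤ B := by
    have h3 : 0 ≤ (√τ - Np) ^ 2 := sq_nonneg _
    rw [sub_sq, Real.sq_sqrt hτ.le] at h3
    have h4 : √τ * (1 / Np) ≤ τ / Np + 1 := by
      rw [← sub_nonneg]
      have h5 : τ / Np + 1 - √τ * (1 / Np) = (τ + Np - √τ) / Np := by field_simp
      rw [h5]
      refine div_nonneg ?_ hNp0.le
      nlinarith [Real.sq_sqrt hτ.le, sq_nonneg (√τ - 1)]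
    have : 0 ≤ 2 * τ / n + √(τ * E / n) := by positivity
    linarith
  have hK : 0 ≤ M * c * (√τ / Np) := by positivity
  calc _ = M * c / Np * (24 * lg * √τ +
          6 * (√(1 / τ + 8 * κ ^ 2 * (1 + 2 * E) * l / n) * τ)) +
        12 * c * (M * c * (√τ / Np)) * (√τ * (1 / Np)) := by
        have h6 : √τ * √τ = τ := Real.mul_self_sqrt hτ.le
        have h7 : 12 * c * (M * c * (√τ / Np)) * (√τ * (1 / Np)) =
          12 * (√τ * √τ) * M * (c / Np) ^ 2 := by ring
        rw [h7, h6]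
        ring
    _ ≤ M * c / Np * (24 * lg * √τ + 6 * (√τ * ((1 + 4 * κ) * l * B))) +
        12 * c * (M * c * (√τ / Np)) * B := by gcongr
    _ = M * c * (√τ / Np) * (24 * lg + 6 * (1 + 4 * κ) * (l * B) + 12 * c * B) := by ring
    _ ≤ M * c * (√τ / Np) * (24 * (l * lg * B) + 6 * (1 + 4 * κ) * (l * lg * B) +
          12 * c * (l * lg * B)) := by
        have i1 : lg ≤ l * lg * B :=
          (le_mul_of_one_le_left (by linarith) hl).trans (le_mul_of_one_le_right (by linarith) hB1)
        have i2 : l * B ≤ l * lg * B := by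
          have : 0 ≤ l * B := by positivity
          nlinarith
        have i3 : B ≤ l * lg * B := le_mul_of_one_le_left (by linarith) hll
        gcongr
    _ = _ := by ring

/-- The second-stage bound for bounded labels. The bad event consists of the failure of the
covariance event and of a null set on which some label exceeds `M`. -/
lemma gapBound_of_bounded_labels (hκ : 0 ≤ κ) (hγ : 0 ≤ γ) (hL : 0 < L) (hα : 0 < α) (hα1 : α ≤ 1)
    (h : KernelAssumptions HG HK κ γ L α) (P : Measure (ProbabilityMeasure X × ℝ))
    [IsProbabilityMeasure P] {M : ℝ} (hM : 0 ≤ M) (hP : ∀ᵐ z ∂P, |z.2| ≤ M)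
    (n N T : ℕ) [NeZero n] [NeZero N] {η δ : ℝ} (hη : 0 < η) (hηκ : η * κ ^ 2 ≤ 1) (hT : 3 ≤ T)
    (hδ : 0 < δ) (hδ1 : δ ≤ 1) {b : ℝ}
    (hb : M * (L * √(1 + γ ^ 2)) * (30 + 24 * κ + 12 * (L * √(1 + γ ^ 2))) * Real.log (4 / δ) *
      Real.log T * (√(η * T) / (N : ℝ) ^ (α / 2)) *
        calB (intOp (SK hκ hα h P)) n N α η T ≤ b) :
    GapBound P (SK hκ hα h P) n N η T δ b := by
  have hn0 : 0 < n := Nat.pos_of_ne_zero (NeZero.ne n)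
  have hn : (0 : ℝ) < n := by exact_mod_cast hn0
  have hN1 : (1 : ℝ) ≤ N := by exact_mod_cast Nat.one_le_iff_ne_zero.2 (NeZero.ne N)
  have hT0 : (0 : ℝ) < T := by exact_mod_cast (by omega : 0 < T)
  have hτ : 0 < η * T := by positivity
  have hl : 1 ≤ Real.log (4 / δ) := by
    rw [Real.le_log_iff_exp_le (by positivity)]
    have : (4 : ℝ) ≤ 4 / δ := by rw [le_div_iff₀ hδ]; linarith
    linarith [Real.exp_one_lt_d9]
  set l := Real.log (4 / δ) with hldef
  set S := SK hκ hα h P with hSdef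
  set E := effDim (intOp S) (1 / (η * T)) with hE
  have hE0 : 0 ≤ E := effDim_nonneg S (by positivity)
  set lam₁ := 1 / (η * T) + 8 * κ ^ 2 * (1 + 2 * E) * l / n with hlam₁
  have hextra : 0 ≤ 8 * κ ^ 2 * (1 + 2 * E) * l / n := by positivity
  have hlam₁0 : 0 ≤ lam₁ := by positivity
  have hgood := measure_first_stage_not_covariance_le hκ hα h P (lam := 1 / (η * T))
    (lam₁ := lam₁) (l := l) hn0 (by positivity) (by linarith) (by linarith)
    (by rw [← hSdef, ← hE, hlam₁]; linarith [show 0 < 1 / (η * T) by positivity])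
  have hlabels : (Measure.pi fun _ : Fin n => P) {z | ¬ ∀ j, |(z j).2| ≤ M} = 0 := by
    have : ∀ᵐ z ∂(Measure.pi fun _ : Fin n => P), ∀ j, |(z j).2| ≤ M :=
      ae_all_iff.2 fun j => (Measure.quasiMeasurePreserving_eval (fun _ : Fin n => P) j).ae hP
    exact this
  have hexp : 2 * Real.exp (-l) ≤ δ := by
    rw [Real.exp_neg, hldef, Real.exp_log (by positivity)]
    field_simp
    norm_num
  unfold GapBound
  refine (measure_mono (t := {z | ¬ ∀ f : HK, ‖S f‖ ^ 2 ≤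
      2 * (1 / n * ∑ j, inner ℝ (kerSec HK (emb HG (z j).1)) f ^ 2) + lam₁ * ‖f‖ ^ 2} ∪
      {z | ¬ ∀ j, |(z j).2| ≤ M}) fun z hz => ?_).trans ((measure_union_le _ _).trans ?_)
  · by_contra hcon
    rw [Set.mem_union, not_or] at hcon
    obtain ⟨h1, h2⟩ := hcon
    have h1 := not_not.1 h1
    have h2 := not_not.1 h2
    obtain ⟨hint, hle⟩ := integrable_gdGap_and_integral_le (N := N) hκ hγ hL hα hα1 h S hη hηκ hT
      hM hlam₁0 h2 h1 rfl
    refine hz ⟨hint, hle.trans (le_trans ?_ hb)⟩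
    exact gap_bound_le hκ hM (by positivity) hτ hl (one_le_log_of_three_le hT)
      (Real.one_le_rpow hN1 (by positivity)) hE0 hn
  · rw [hlabels, add_zero]
    exact hgood.trans (ENNReal.ofReal_le_ofReal hexp)

end Final

end DistReg

theorem mainTheorem7 (κ γ L α M : ℝ) (hκ : 0 ≤ κ) (hγ : 0 ≤ γ) (hL : 0 < L)
    (hα : 0 < α) (hα1 : α ≤ 1) (hM : 0 < M) :
    ∃ (C₁ : ℝ) (C₂ : ℝ → ℝ),
      ∀ (X : Type u) [TopologicalSpace X] [CompactSpace X] [MeasurableSpace X] [BorelSpace X]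
        (HG : Type v) [NormedAddCommGroup HG] [InnerProductSpace ℝ HG] [CompleteSpace HG]
        [MeasurableSpace HG] [BorelSpace HG] [RKHS ℝ HG X ℝ]
        (HK : Type w) [NormedAddCommGroup HK] [InnerProductSpace ℝ HK] [CompleteSpace HK]
        [RKHS ℝ HK (EmbSpace HG) ℝ]
        (hK : KernelAssumptions HG HK κ γ L α)
        (P : Measure (ProbabilityMeasure X × ℝ))
        [IsProbabilityMeasure P]
        (_ : ∀ᵐ z ∂P, |z.2| ≤ M)
        (n N T : ℕ) [NeZero n] [NeZero N] (η δ : ℝ)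
        (_ : 0 < η) (_ : η * κ ^ 2 < 1) (_ : 3 ≤ T) (_ : 0 < δ) (_ : δ ≤ 1)
        (_ : 32 * κ ^ 2 * Real.log (4 / δ) / (1 / (η * T)) *
            Real.log (Real.exp 1 * effDim (intOp (SK hκ hα hK P)) (1 / (η * T)) *
              (1 + 1 / (η * T) / ‖covOp (SK hκ hα hK P)‖)) ≤ n),
        (WellSpecified P (SK hκ hα hK P) →
          GapBound P (SK hκ hα hK P) n N η T δ
            (C₁ * Real.log (4 / δ) * Real.log T * (√(η * T) / (N : ℝ) ^ (α / 2)) *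
              calB (intOp (SK hκ hα hK P)) n N α η T)) ∧
        (∀ r ν R c : ℝ, 0 < r → 0 < ν → ν ≤ 1 →
          SourceCondition P (SK hκ hα hK P) r R →
          (∀ lam : ℝ, 0 < lam → effDim (intOp (SK hκ hα hK P)) lam ≤ c * lam ^ (-ν)) →
          ¬ WellSpecified P (SK hκ hα hK P) →
          GapBound P (SK hκ hα hK P) n N η T δ
            (C₂ r * Real.log (4 / δ) * Real.log T *
              (√(η * T) * calB (intOp (SK hκ hα hK P)) n N α η T / (N : ℝ) ^ (α / 2)) *
              (1 + phi ν r (η * T)))) := by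
  refine ⟨M * (L * √(1 + γ ^ 2)) * (30 + 24 * κ + 12 * (L * √(1 + γ ^ 2))),
    fun _ => M * (L * √(1 + γ ^ 2)) * (30 + 24 * κ + 12 * (L * √(1 + γ ^ 2))), ?_⟩
  intro X _ _ _ _ HG _ _ _ _ _ _ HK _ _ _ _ hK P _ hP n N T _ _ η δ hη hηκ hT hδ hδ1 _
  refine ⟨fun _ => gapBound_of_bounded_labels hκ hγ hL hα hα1 hK P hM.le hP n N T hη hηκ.le hT hδ
    hδ1 le_rfl, fun r ν R c _ _ _ _ _ _ => gapBound_of_bounded_labels hκ hγ hL hα hα1 hK P hM.le hP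
    n N T hη hηκ.le hT hδ hδ1 ?_⟩
  have hτ : 0 ≤ η * T := by positivity
  have hphi : 0 ≤ phi ν r (η * T) := Real.rpow_nonneg hτ _
  have hl : 0 ≤ Real.log (4 / δ) := Real.log_nonneg (by rw [le_div_iff₀ hδ]; linarith)
  have hlg : 0 ≤ Real.log T := zero_le_one.trans (one_le_log_of_three_le hT)
  have hE : 0 ≤ effDim (intOp (SK hκ hα hK P)) (1 / (η * T)) :=
    effDim_nonneg (SK hκ hα hK P) (by have : 0 < T := by omega
                                      positivity)
  have hB : 0 ≤ calB (intOp (SK hκ hα hK P)) n N α η T := by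
    unfold calB
    positivity
  refine le_trans (le_of_eq ?_) (le_mul_of_one_le_right (by positivity)
    (by linarith : (1 : ℝ) ≤ 1 + phi ν r (η * T)))
  ring
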